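/- Let $0<s\le 1/8$ and, for $j=1,2,3,4$, let $F_j:\mathbb R^2\to\mathbb R^2$ be the affine map $$F_j\begin{bmatrix}x_1\\x_2\end{bmatrix}=\frac12\begin{bmatrix}1&0\\(-1)^j&4s\end{bmatrix}\begin{bmatrix}x_1\\x_2\end{bmatrix}+\frac1{\sqrt2}\begin{bmatrix}\cos((2j-1)\pi/4)\\ \sin((2j-1)\pi/4)\end{bmatrix},$$ so that the diamond lattice fractal $X$ is the non-empty compact set with $X=\bigcup_j F_j(X)$. Put $V_0=\{(-1,0),(1,0)\}$, $V_m=\bigcup_jF_j(V_{m-1})$, $V_*=\bigcup_mV_m$, which is dense in $X$. For a word $w=w_1\cdots w_m$ in the letters $1,2,3,4$ put $F_w=F_{w_1}\circ\cdots\circ F_{w_m}$ and $|w|=m$. The edges of the scale-$m$ graph are indexed by the words of length $m$: the edge of $w$ joins $F_w(-1,0)$ and $F_w(1,0)$, and $x\sim_m y$ means that $x,y$ are joined by such an edge. For $f:V_*\to\mathbb C$ let $\mathcal E_m(f)=\frac12\sum_{x\in V_m}\sum_{y\sim_mx}|f(x)-f(y)|^2$, which is non-decreasing in $m$, and let $\mathcal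 F$ be the algebra of the bounded functions $f:V_*\to\mathbb C$ for which $\mathcal E(f)=\lim_m\mathcal E_m(f)$ is finite (in particular, it contains the restrictions to $V_*$ of all continuous functions on $X$ of finite energy). A function $A\in\mathcal F$ is harmonic at scale $n$ if $\mathcal E_m(A)=\mathcal E_n(A)$ for all $m\ge n$. The Hilbert space $\mathcal H$ of $1$-forms is the completion, after division by the null vectors, of the linear span of the elementary forms $\mathbb 1_u\,g\,\partial f$ ($u$ a word, $g,f\in\mathcal F$) for the inner product $$\langle \mathbb 1_u\,g\,\partial f,\ \mathbb 1_v\,k\,\partial h\rangle_{\mathcal H}=\lim_{m\to\infty}\sum_{w} g(x_w)\overline{k(x_w)}\,\bigl(f(y_w)-f(x_w)\bigr)\overline{\bigl(h(y_w)-h(x_w)\bigr)},\qquad x_w=F_w(-1,0),\ y_w=F_w(1,0),$$ where $w$ runs over the words of length $m$ that begin with $u$ and with $v$ (this is the integral of $\mathbb 1_u\mathbb 1_v\,g\bar k$ against the mutual energy measure of $f$ and $h$). The derivation $\partial:\mathcal F\to\mathcal H$, with $\|\partial f\|_{\mathcal H}^2=\mathcal E(f)$, the bounded multiplication by functions in $\mathcal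 F$, and the bounded multiplication by the characteristic function $\mathbb 1_w$ of the cell $F_w(X)$ (restriction to the edges in that cell) are the evident ones. A form $a\in\mathcal H$ is real-valued if it is a limit of finite sums of elementary forms all of whose values on edges are real. For a real-valued $a\in\mathcal H$ and $f\in\mathcal F$ the magnetic form is $$\mathcal E^a(f)=\|(\partial+ia)f\|_{\mathcal H}^2=\|\partial f+i\,f a\|_{\mathcal H}^2 .$$ Let $\mathcal H_n\subset\mathcal H$ be the (finite-dimensional) span of the forms $\mathbb 1_w\,\partial A$ with $|w|=n$ and $A$ harmonic at scale $n$, and let $a_n$ be the orthogonal projection of $a$ to $\mathcal H_n$. Write $a_n=\sum_{|w|=n}\mathbb 1_w\,\partial A_w$ with all $A_w$ harmonic at scale $n$, and for the directed edge $e_{xy}$ from $x$ to $y$ of the word $w$ (so $\{x,y\}=\{F_w(-1,0),F_w(1,0)\}$) put $a_n(e_{xy})=A_w(y)-A_w(x)$. The graph magnetic energy is $$\mathcal E_n^{a_n}(f)=\frac12\sum_{x\in V_n}\sum_{y\sim_nx}\bigl|f(x)-f(y)e^{i a_n(e_{xy})}\bigr|^2 .$$ **Theorem.** For every real-valued $a\in\mathcal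 H$ and every $f\in\mathcal F$, $$\mathcal E_n^{a_n}(f)\longrightarrow\mathcal E^a(f)\qquad(n\to\infty).$$ -/

import Mathlib

open Filter Topology ComplexConjugate

noncomputable section

namespace DiamondFractal

/-! ### The self-similar maps, the vertices and the edges -/

/-- The affine map `F_{j+1}` of the plane (`j = 0,1,2,3`), with scaling factor `s`:
`F_j x = (1/2) [[1, 0], [(-1)^j, 4 s]] x + (1/√2) (cos ((2j-1)π/4), sin ((2j-1)π/4))`;
the translation vectors are `(±1/2, ±1/2)`. -/
def ifsMap (s : ℝ) (j : Fin 4) (p : ℝ × ℝ) : ℝ × ℝ :=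
  (p.1 / 2 + ![1 / 2, -1 / 2, -1 / 2, 1 / 2] j,
    ((-1) ^ ((j : ℕ) + 1) * p.1 + 4 * s * p.2) / 2 + ![1 / 2, 1 / 2, -1 / 2, -1 / 2] j)

/-- `V_0` is the pair of end points of `[-1,1] × {0}` and `V_{m+1} = ⋃_j F_j (V_m)`. -/
def vertices (s : ℝ) : ℕ → Set (ℝ × ℝ)
  | 0 => {(-1, 0), (1, 0)}
  | m + 1 => ⋃ j : Fin 4, ifsMap s j '' vertices s m

/-- `V_* = ⋃_m V_m`. -/
abbrev VStar (s : ℝ) : Type := ↥(⋃ m, vertices s m)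

/-- A word `w = w₁ ⋯ w_m` over the alphabet of four letters; its length is `m`. -/
abbrev Word : Type := List (Fin 4)

/-- `F_w = F_{w₁} ∘ ⋯ ∘ F_{w_m}`. -/
def cellMap (s : ℝ) (w : Word) (p : ℝ × ℝ) : ℝ × ℝ := w.foldr (ifsMap s) p

lemma cellMap_mem (s : ℝ) (w : Word) {p : ℝ × ℝ} (hp : p ∈ vertices s 0) :
    cellMap s w p ∈ vertices s w.length := by
  induction w with
  | nil => exact hp
  | cons j w ih => exact Set.mem_iUnion.2 ⟨j, _, ih, rfl⟩

/-- The left end point `F_w(-1,0)` of the edge `F_w([-1,1] × {0})`. -/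
def left (s : ℝ) (w : Word) : VStar s :=
  ⟨cellMap s w (-1, 0), Set.mem_iUnion.2 ⟨_, cellMap_mem s w (by simp [vertices])⟩⟩

/-- The right end point `F_w(1,0)` of the edge `F_w([-1,1] × {0})`. -/
def right (s : ℝ) (w : Word) : VStar s :=
  ⟨cellMap s w (1, 0), Set.mem_iUnion.2 ⟨_, cellMap_mem s w (by simp [vertices])⟩⟩

/-- The difference of `f` along the edge of the word `w`, directed from left to right. -/
def diff (s : ℝ) (f : VStar s → ℂ) (w : Word) : ℂ := f (right s w) - f (left s w)

/-- The sum over the edges of the scale `m` graph, that is, over the words of length `m`. -/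
def edgeSum {M : Type*} [AddCommMonoid M] (m : ℕ) (φ : Word → M) : M :=
  ∑ w : Fin m → Fin 4, φ (List.ofFn w)

/-- The graph energy `E_m(f) = (1/2) ∑_x ∑_{y ∼_m x} |f x - f y|²`; each undirected edge
occurs here once. -/
def graphEnergy (s : ℝ) (m : ℕ) (f : VStar s → ℂ) : ℝ :=
  edgeSum m fun w => ‖diff s f w‖ ^ 2

/-! ### Elementary facts about the graph energies -/

section energies

variable {s : ℝ}

lemma edgeSum_succ {M : Type*} [AddCommMonoid M] (m : ℕ) (φ : Word → M) :
    edgeSum (m + 1) φ = edgeSum m fun w => ∑ j : Fin 4, φ (w ++ [j]) := by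
  unfold edgeSum
  rw [← (Fin.snocEquiv fun _ : Fin (m + 1) => Fin 4).sum_comp, Fintype.sum_prod_type,
    Finset.sum_comm]
  refine Finset.sum_congr rfl fun w _ => Finset.sum_congr rfl fun j _ => ?_
  congr 1
  rw [List.ofFn_succ_last]
  simp [Fin.snocEquiv]

lemma edgeSum_mono {m : ℕ} {φ ψ : Word → ℝ} (h : ∀ w, φ w ≤ ψ w) :
    edgeSum m φ ≤ edgeSum m ψ := Finset.sum_le_sum fun _ _ => h _

lemma edgeSum_nonneg {m : ℕ} {φ : Word → ℝ} (h : ∀ w, 0 ≤ φ w) : 0 ≤ edgeSum m φ :=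
  Finset.sum_nonneg fun _ _ => h _

lemma edgeSum_add {M : Type*} [AddCommMonoid M] (m : ℕ) (φ ψ : Word → M) :
    edgeSum m (fun w => φ w + ψ w) = edgeSum m φ + edgeSum m ψ := Finset.sum_add_distrib

lemma edgeSum_mul {R : Type*} [NonUnitalNonAssocSemiring R] (m : ℕ) (c : R) (φ : Word → R) :
    edgeSum m (fun w => c * φ w) = c * edgeSum m φ := (Finset.mul_sum _ _ _).symm

/-- The two edges of the upper, and of the lower, half of a cell add up to its edge. -/
lemma diff_children (f : VStar s → ℂ) (w : Word) :
    diff s f (w ++ [0]) + diff s f (w ++ [1]) = diff s f w ∧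
      diff s f (w ++ [2]) + diff s f (w ++ [3]) = diff s f w := by
  have e (p q : ℝ × ℝ) (i j : Fin 4) (h : ifsMap s i p = ifsMap s j q) :
      cellMap s (w ++ [i]) p = cellMap s (w ++ [j]) q := by simp [cellMap, h]
  have e' (p q : ℝ × ℝ) (i : Fin 4) (h : ifsMap s i p = q) :
      cellMap s (w ++ [i]) p = cellMap s w q := by simp [cellMap, h]
  have h1 : right s (w ++ [0]) = right s w :=
    Subtype.ext (e' _ _ 0 (by simp [ifsMap]; norm_num))
  have h2 : left s (w ++ [0]) = right s (w ++ [1]) :=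
    Subtype.ext (e _ _ 0 1 (by simp [ifsMap]; norm_num))
  have h3 : left s (w ++ [1]) = left s w :=
    Subtype.ext (e' _ _ 1 (by simp [ifsMap]; norm_num))
  have h4 : left s (w ++ [2]) = left s w :=
    Subtype.ext (e' _ _ 2 (by simp [ifsMap]; norm_num))
  have h5 : right s (w ++ [2]) = left s (w ++ [3]) :=
    Subtype.ext (e _ _ 2 3 (by simp [ifsMap]; norm_num))
  have h6 : right s (w ++ [3]) = right s w :=
    Subtype.ext (e' _ _ 3 (by simp [ifsMap]; norm_num))
  simp only [diff, h1, h2, h3, h4, h5, h6]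
  constructor <;> ring

/-- The energy on the edges of `w ++ [j]` exceeds that on the edge `w` by the deviation of the
two middle points from the average. -/
lemma sum_children (f : VStar s → ℂ) (w : Word) :
    ∑ j : Fin 4, ‖diff s f (w ++ [j])‖ ^ 2 = ‖diff s f w‖ ^ 2 +
      (‖diff s f (w ++ [0]) - diff s f (w ++ [1])‖ ^ 2 +
        ‖diff s f (w ++ [2]) - diff s f (w ++ [3])‖ ^ 2) / 2 := by
  have h1 := parallelogram_law_with_norm ℂ (diff s f (w ++ [0])) (diff s f (w ++ [1]))
  have h2 := parallelogram_law_with_norm ℂ (diff s f (w ++ [2])) (diff s f (w ++ [3]))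
  rw [(diff_children f w).1] at h1
  rw [(diff_children f w).2] at h2
  rw [Fin.sum_univ_four]
  nlinarith

open Classical in
/-- The energy on the edges with word in `S`. -/
def energyOn (s : ℝ) (S : Set Word) (m : ℕ) (f : VStar s → ℂ) : ℝ :=
  edgeSum m fun w => if w ∈ S then ‖diff s f w‖ ^ 2 else 0

/-- A set of words that contains, with a word, every longer word which starts with it. -/
def Hereditary (S : Set Word) : Prop := ∀ w ∈ S, ∀ j : Fin 4, w ++ [j] ∈ S

lemma energyOn_mono {S : Set Word} (hS : Hereditary S) (f : VStar s → ℂ) :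
    Monotone fun m => energyOn s S m f := by
  classical
  refine monotone_nat_of_le_succ fun m => ?_
  unfold energyOn
  rw [edgeSum_succ]
  refine edgeSum_mono fun w => ?_
  by_cases hw : w ∈ S
  · simp only [hw, hS w hw, if_true]
    rw [sum_children]
    have : 0 ≤ (‖diff s f (w ++ [0]) - diff s f (w ++ [1])‖ ^ 2 +
        ‖diff s f (w ++ [2]) - diff s f (w ++ [3])‖ ^ 2) / 2 := by positivity
    linarith
  · simp only [hw, if_false]
    exact Finset.sum_nonneg fun j _ => by split_ifs <;> positivity

lemma energyOn_univ (m : ℕ) (f : VStar s → ℂ) :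
    energyOn s Set.univ m f = graphEnergy s m f := by
  simp [energyOn, graphEnergy]

lemma energyOn_le (S : Set Word) (m : ℕ) (f : VStar s → ℂ) :
    energyOn s S m f ≤ graphEnergy s m f := by
  classical
  refine edgeSum_mono fun w => ?_
  split_ifs
  · exact le_rfl
  · positivity

lemma graphEnergy_mono (f : VStar s → ℂ) : Monotone fun m => graphEnergy s m f := by
  have h := energyOn_mono (S := Set.univ) (fun _ _ _ => trivial) f
  simpa only [energyOn_univ] using h

lemma graphEnergy_nonneg (m : ℕ) (f : VStar s → ℂ) : 0 ≤ graphEnergy s m f :=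
  edgeSum_nonneg fun _ => by positivity

lemma converges_iff (f : VStar s → ℂ) :
    (∃ L, Tendsto (fun m => graphEnergy s m f) atTop (𝓝 L)) ↔ ∃ C, ∀ m, graphEnergy s m f ≤ C := by
  constructor
  · rintro ⟨L, hL⟩
    exact ⟨L, fun m => (graphEnergy_mono f).ge_of_tendsto hL m⟩
  · rintro ⟨C, hC⟩
    exact ⟨_, tendsto_atTop_ciSup (graphEnergy_mono f) ⟨C, by rintro _ ⟨m, rfl⟩; exact hC m⟩⟩

end energies

/-! ### The domain `𝓕` of the resistance form -/

/-- `f : V_* → ℂ` is bounded and its graph energies `E_m(f)` have a finite limit. -/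
def IsFiniteEnergy (s : ℝ) (f : VStar s → ℂ) : Prop :=
  (∃ C, ∀ x, ‖f x‖ ≤ C) ∧ ∃ L, Tendsto (fun m => graphEnergy s m f) atTop (𝓝 L)

lemma isFiniteEnergy_iff {s : ℝ} {f : VStar s → ℂ} :
    IsFiniteEnergy s f ↔ (∃ C, ∀ x, ‖f x‖ ≤ C) ∧ ∃ C, ∀ m, graphEnergy s m f ≤ C := by
  rw [IsFiniteEnergy, converges_iff]

/-- The space `𝓕` of bounded functions of finite energy, a subalgebra of the functions on `V_*`
that is closed under complex conjugation. -/
def finiteEnergy (s : ℝ) : StarSubalgebra ℂ (VStar s → ℂ) where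
  carrier := {f | IsFiniteEnergy s f}
  mul_mem' := by
    intro f g hf hg
    simp only [Set.mem_ofPred_eq, isFiniteEnergy_iff] at hf hg ⊢
    obtain ⟨⟨A, hA⟩, C, hC⟩ := hf
    obtain ⟨⟨B, hB⟩, D, hD⟩ := hg
    refine ⟨⟨A * B, fun x => ?_⟩, 2 * (B ^ 2 * C + A ^ 2 * D), fun m => ?_⟩
    · rw [Pi.mul_apply, norm_mul]
      exact mul_le_mul (hA x) (hB x) (norm_nonneg _) ((norm_nonneg _).trans (hA x))
    · have key : graphEnergy s m (f * g) ≤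
          2 * (B ^ 2 * graphEnergy s m f + A ^ 2 * graphEnergy s m g) := by
        unfold graphEnergy
        rw [← edgeSum_mul, ← edgeSum_mul, ← edgeSum_add, ← edgeSum_mul]
        refine edgeSum_mono fun w => ?_
        have e : diff s (f * g) w =
            g (right s w) * diff s f w + f (left s w) * diff s g w := by
          simp only [diff, Pi.mul_apply]; ring
        have h1 : ‖diff s (f * g) w‖ ≤ B * ‖diff s f w‖ + A * ‖diff s g w‖ := by
          rw [e]
          refine (norm_add_le _ _).trans (add_le_add ?_ ?_)
          · rw [norm_mul]; exact mul_le_mul_of_nonneg_right (hB _) (norm_nonneg _)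
          · rw [norm_mul]; exact mul_le_mul_of_nonneg_right (hA _) (norm_nonneg _)
        have h2 := pow_le_pow_left₀ (norm_nonneg _) h1 2
        nlinarith [sq_nonneg (B * ‖diff s f w‖ - A * ‖diff s g w‖)]
      have := mul_le_mul_of_nonneg_left (hC m) (sq_nonneg B)
      have := mul_le_mul_of_nonneg_left (hD m) (sq_nonneg A)
      linarith
  add_mem' := by
    intro f g hf hg
    simp only [Set.mem_ofPred_eq, isFiniteEnergy_iff] at hf hg ⊢
    obtain ⟨⟨A, hA⟩, C, hC⟩ := hf
    obtain ⟨⟨B, hB⟩, D, hD⟩ := hg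
    refine ⟨⟨A + B, fun x => (norm_add_le _ _).trans (add_le_add (hA x) (hB x))⟩,
      2 * (C + D), fun m => ?_⟩
    have key : graphEnergy s m (f + g) ≤ 2 * (graphEnergy s m f + graphEnergy s m g) := by
      unfold graphEnergy
      rw [← edgeSum_add, ← edgeSum_mul]
      refine edgeSum_mono fun w => ?_
      have e : diff s (f + g) w = diff s f w + diff s g w := by
        simp only [diff, Pi.add_apply]; ring
      have h1 : ‖diff s (f + g) w‖ ≤ ‖diff s f w‖ + ‖diff s g w‖ := e ▸ norm_add_le _ _
      have h2 := pow_le_pow_left₀ (norm_nonneg _) h1 2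
      nlinarith [sq_nonneg (‖diff s f w‖ - ‖diff s g w‖)]
    linarith [hC m, hD m]
  algebraMap_mem' := by
    intro c
    simp only [Set.mem_ofPred_eq, isFiniteEnergy_iff]
    refine ⟨⟨‖c‖, fun x => le_rfl⟩, 0, fun m => ?_⟩
    simp [graphEnergy, diff, edgeSum]
  star_mem' := by
    intro f hf
    simp only [Set.mem_ofPred_eq, isFiniteEnergy_iff] at hf ⊢
    obtain ⟨⟨A, hA⟩, C, hC⟩ := hf
    refine ⟨⟨A, fun x => by simpa using hA x⟩, C, fun m => ?_⟩
    have : graphEnergy s m (star f) = graphEnergy s m f := by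
      unfold graphEnergy
      congr 1
      ext w
      have : diff s (star f) w = star (diff s f w) := by simp [diff]
      rw [this, norm_star]
    rw [this]; exact hC m

/-- The Dirichlet energy `E(f) = lim_m E_m(f)`. -/
def energy (s : ℝ) (f : finiteEnergy s) : ℝ :=
  limUnder atTop fun m => graphEnergy s m f

/-- `f` is harmonic at scale `n`: the energies `E_m(f)`, `m ≥ n`, are all equal. -/
def IsHarmonicAtScale (s : ℝ) (n : ℕ) (f : finiteEnergy s) : Prop :=
  ∀ m, n ≤ m → graphEnergy s m f = graphEnergy s n f

section limits

variable {s : ℝ}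

lemma finiteEnergy_bounded (f : finiteEnergy s) : ∃ C, ∀ x, ‖(f : VStar s → ℂ) x‖ ≤ C := f.2.1

lemma graphEnergy_bounded (f : finiteEnergy s) : ∃ C, ∀ m, graphEnergy s m f ≤ C :=
  (isFiniteEnergy_iff.1 f.2).2

lemma diff_add (f g : VStar s → ℂ) (w : Word) : diff s (f + g) w = diff s f w + diff s g w := by
  simp only [diff, Pi.add_apply]; ring

lemma diff_smul (c : ℂ) (f : VStar s → ℂ) (w : Word) : diff s (c • f) w = c * diff s f w := by
  simp only [diff, Pi.smul_apply, smul_eq_mul]; ring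

lemma diff_star (f : VStar s → ℂ) (w : Word) : diff s (star f) w = conj (diff s f w) := by
  simp [diff]

lemma energyOn_tendsto {S : Set Word} (hS : Hereditary S) (f : finiteEnergy s) :
    ∃ L, Tendsto (fun m => energyOn s S m f) atTop (𝓝 L) := by
  obtain ⟨C, hC⟩ := graphEnergy_bounded f
  have hmono := energyOn_mono hS (f : VStar s → ℂ)
  have hle (m : ℕ) : energyOn s S m f ≤ C := (energyOn_le S m _).trans (hC m)
  have hb : BddAbove (Set.range fun m => energyOn s S m f) := by
    refine ⟨C, ?_⟩
    rintro _ ⟨m, rfl⟩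
    exact hle m
  exact ⟨_, tendsto_atTop_ciSup hmono hb⟩

lemma coe_add (f g : finiteEnergy s) :
    ((f + g : finiteEnergy s) : VStar s → ℂ) = (f : VStar s → ℂ) + (g : VStar s → ℂ) := rfl

lemma coe_mul (f g : finiteEnergy s) :
    ((f * g : finiteEnergy s) : VStar s → ℂ) = (f : VStar s → ℂ) * (g : VStar s → ℂ) := rfl

lemma coe_smul (c : ℂ) (f : finiteEnergy s) :
    ((c • f : finiteEnergy s) : VStar s → ℂ) = c • (f : VStar s → ℂ) := rfl

lemma coe_star (f : finiteEnergy s) :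
    ((star f : finiteEnergy s) : VStar s → ℂ) = star (f : VStar s → ℂ) := rfl

open Classical in
/-- The sum of `φ` over the words of length `m` in `S`. -/
def sumOn (S : Set Word) (m : ℕ) (φ : Word → ℂ) : ℂ := edgeSum m fun w => if w ∈ S then φ w else 0

lemma sumOn_add (S : Set Word) (m : ℕ) (φ ψ : Word → ℂ) :
    sumOn S m (fun w => φ w + ψ w) = sumOn S m φ + sumOn S m ψ := by
  classical
  unfold sumOn
  rw [← edgeSum_add]
  congr 1; ext w; split_ifs <;> simp

lemma sumOn_mul (S : Set Word) (m : ℕ) (c : ℂ) (φ : Word → ℂ) :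
    sumOn S m (fun w => c * φ w) = c * sumOn S m φ := by
  classical
  unfold sumOn
  rw [← edgeSum_mul]
  congr 1; ext w; split_ifs <;> simp

lemma sumOn_norm_sq (S : Set Word) (m : ℕ) (f : VStar s → ℂ) :
    sumOn S m (fun w => (‖diff s f w‖ : ℂ) ^ 2) = (energyOn s S m f : ℂ) := by
  classical
  simp only [sumOn, energyOn, edgeSum]
  push_cast
  refine Finset.sum_congr rfl fun w _ => ?_
  split_ifs <;> simp

/-- The polarized energies converge. -/
lemma sumOn_diff_tendsto {S : Set Word} (hS : Hereditary S) (f g : finiteEnergy s) :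
    ∃ L, Tendsto (fun m => sumOn S m fun w => diff s f w * diff s g w) atTop (𝓝 L) := by
  obtain ⟨L₁, h₁⟩ := energyOn_tendsto hS (star f + g)
  obtain ⟨L₂, h₂⟩ := energyOn_tendsto hS (star f + (-1 : ℂ) • g)
  obtain ⟨L₃, h₃⟩ := energyOn_tendsto hS (star f + (-Complex.I) • g)
  obtain ⟨L₄, h₄⟩ := energyOn_tendsto hS (star f + Complex.I • g)
  have c {u : ℕ → ℝ} {L : ℝ} (h : Tendsto u atTop (𝓝 L)) :
      Tendsto (fun m => (u m : ℂ)) atTop (𝓝 (L : ℂ)) :=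
    (Complex.continuous_ofReal.tendsto L).comp h
  refine ⟨_, ((((c h₁).const_mul (1 / 4)).add ((c h₂).const_mul (-1 / 4))).add
    (((c h₃).const_mul (Complex.I / 4)).add ((c h₄).const_mul (-Complex.I / 4)))).congr
    fun m => ?_⟩
  simp only [← sumOn_norm_sq, ← sumOn_mul, ← sumOn_add]
  congr 1; ext w
  simp only [coe_add, coe_smul, coe_star, diff_add,
    diff_smul, diff_star, ← Complex.conj_mul', map_add, map_mul, map_neg, Complex.conj_conj,
    Complex.conj_I, map_one]
  linear_combination (conj (diff s f w) * conj (diff s g w) / 2 - diff s f w * diff s g w / 2) *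
    Complex.I_sq

lemma halving_tendsto {u e : ℕ → ℝ} (hu : ∀ m, 0 ≤ u m) (h : ∀ m, u (m + 1) ≤ u m / 2 + e m)
    (he : Tendsto e atTop (𝓝 0)) : Tendsto u atTop (𝓝 0) := by
  rw [Metric.tendsto_atTop]
  intro ε hε
  obtain ⟨N, hN⟩ := Metric.tendsto_atTop.1 he (ε / 8) (by positivity)
  have key : ∀ k, u (N + k) ≤ u N * (1 / 2) ^ k + ε / 4 := by
    intro k
    induction k with
    | zero => simp; positivity
    | succ k ih =>
      have h1 := h (N + k)
      have h2 := hN (N + k) (by omega)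
      rw [Real.dist_eq, sub_zero] at h2
      have h3 := (abs_lt.1 h2).2
      rw [pow_succ, ← add_assoc]
      linarith
  have ht : Tendsto (fun k : ℕ => u N * (1 / 2 : ℝ) ^ k) atTop (𝓝 (u N * 0)) :=
    (tendsto_pow_atTop_nhds_zero_of_lt_one (by norm_num) (by norm_num)).const_mul _
  rw [mul_zero] at ht
  obtain ⟨K, hK⟩ := Metric.tendsto_atTop.1 ht (ε / 4) (by positivity)
  refine ⟨N + K, fun n hn => ?_⟩
  obtain ⟨k, rfl⟩ : ∃ k, n = N + k := ⟨n - N, by omega⟩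
  have h1 := hK k (by omega)
  rw [Real.dist_eq, sub_zero] at h1 ⊢
  rw [abs_of_nonneg (hu _)]
  linarith [key k, (abs_lt.1 h1).2]

/-- The increments of a function of finite energy along the edges tend to zero uniformly. -/
lemma diff_uniform (f : finiteEnergy s) : ∃ M : ℕ → ℝ, Tendsto M atTop (𝓝 0) ∧
    ∀ m (w : Fin m → Fin 4), ‖diff s f (List.ofFn w)‖ ≤ M m := by
  obtain ⟨L, hL⟩ := f.2.2
  set e : ℕ → ℝ := fun m => √(graphEnergy s (m + 1) f - graphEnergy s m f) with he
  have he0 : Tendsto e atTop (𝓝 0) := by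
    have h1 := ((tendsto_add_atTop_iff_nat 1).2 hL).sub hL
    rw [sub_self] at h1
    have h2 := (Real.continuous_sqrt.tendsto 0).comp h1
    rw [Real.sqrt_zero] at h2
    exact h2
  let M : ℕ → ℝ := fun m => Nat.rec ‖diff s f []‖ (fun m x => x / 2 + e m) m
  have hM : ∀ m (w : Fin m → Fin 4), ‖diff s f (List.ofFn w)‖ ≤ M m := by
    intro m
    induction m with
    | zero => intro w; simp [M]
    | succ m ih =>
      intro w
      rw [List.ofFn_succ_last]
      set v : Fin m → Fin 4 := fun i => w i.castSucc
      have hv := ih v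
      have hsum : (‖diff s f (List.ofFn v ++ [0]) - diff s f (List.ofFn v ++ [1])‖ ^ 2 +
          ‖diff s f (List.ofFn v ++ [2]) - diff s f (List.ofFn v ++ [3])‖ ^ 2) / 2 ≤
          graphEnergy s (m + 1) f - graphEnergy s m f := by
        have h1 : graphEnergy s (m + 1) f = graphEnergy s m f + edgeSum m fun w =>
            (‖diff s f (w ++ [0]) - diff s f (w ++ [1])‖ ^ 2 +
              ‖diff s f (w ++ [2]) - diff s f (w ++ [3])‖ ^ 2) / 2 := by
          unfold graphEnergy
          rw [edgeSum_succ, ← edgeSum_add]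
          congr 1; ext w; exact sum_children _ w
        rw [h1, add_sub_cancel_left]
        unfold edgeSum
        exact Finset.single_le_sum (f := fun w : Fin m → Fin 4 =>
          (‖diff s f (List.ofFn w ++ [0]) - diff s f (List.ofFn w ++ [1])‖ ^ 2 +
            ‖diff s f (List.ofFn w ++ [2]) - diff s f (List.ofFn w ++ [3])‖ ^ 2) / 2)
          (fun _ _ => by positivity) (Finset.mem_univ v)
      have hE : 0 ≤ graphEnergy s (m + 1) f - graphEnergy s m f :=
        le_trans (by positivity) hsum
      have hsq : e m ^ 2 = graphEnergy s (m + 1) f - graphEnergy s m f := Real.sq_sqrt hE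
      have he1 : 0 ≤ e m := Real.sqrt_nonneg _
      have gen (p q d : ℂ) (hpq : p + q = d) (hb : ‖p - q‖ ^ 2 / 2 ≤ e m ^ 2) :
          ‖p‖ ≤ ‖d‖ / 2 + e m ∧ ‖q‖ ≤ ‖d‖ / 2 + e m := by
        have h2 : ‖p - q‖ ≤ 2 * e m := by nlinarith [norm_nonneg (p - q)]
        have hp : p = (1 / 2 : ℂ) * d + (1 / 2 : ℂ) * (p - q) := by rw [← hpq]; ring
        have hq : q = (1 / 2 : ℂ) * d - (1 / 2 : ℂ) * (p - q) := by rw [← hpq]; ring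
        have a1 : ‖p‖ ≤ ‖(1 / 2 : ℂ) * d‖ + ‖(1 / 2 : ℂ) * (p - q)‖ := by
          conv_lhs => rw [hp]
          exact norm_add_le _ _
        have a2 : ‖q‖ ≤ ‖(1 / 2 : ℂ) * d‖ + ‖(1 / 2 : ℂ) * (p - q)‖ := by
          conv_lhs => rw [hq]
          exact norm_sub_le _ _
        rw [norm_mul, norm_mul] at a1 a2
        norm_num at a1 a2
        constructor <;> linarith
      have c1 := gen _ _ _ (diff_children (s := s) f (List.ofFn v)).1
        (by rw [hsq]; exact le_trans (by
          have : 0 ≤ ‖diff s f (List.ofFn v ++ [2]) - diff s f (List.ofFn v ++ [3])‖ ^ 2 := by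
            positivity
          linarith) hsum)
      have c2 := gen _ _ _ (diff_children (s := s) f (List.ofFn v)).2
        (by rw [hsq]; exact le_trans (by
          have : 0 ≤ ‖diff s f (List.ofFn v ++ [0]) - diff s f (List.ofFn v ++ [1])‖ ^ 2 := by
            positivity
          linarith) hsum)
      have hM1 : M (m + 1) = M m / 2 + e m := rfl
      generalize w (Fin.last m) = j
      fin_cases j
      · exact c1.1.trans (by linarith)
      · exact c1.2.trans (by linarith)
      · exact c2.1.trans (by linarith)
      · exact c2.2.trans (by linarith)
  refine ⟨M, halving_tendsto (e := e) (fun m => ?_) (fun m => le_rfl) he0, hM⟩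
  exact (norm_nonneg _).trans (hM m fun _ => 0)

/-- For `S` the set of all words, `u = conj b` and `v = d` this limit is the integral
`∫ φ dΓ(d, b) = (1/2) (E(φ d, b) + E(d, conj φ b) - E(d conj b, conj φ))` of `φ` against the
mutual energy measure of `d` and `b`. -/
lemma sumOn_left_tendsto {S : Set Word} (hS : Hereditary S) (φ u v : finiteEnergy s) :
    ∃ L, Tendsto (fun m => sumOn S m fun w => (φ : VStar s → ℂ) (left s w) *
      (diff s u w * diff s v w)) atTop (𝓝 L) := by
  obtain ⟨L₁, h₁⟩ := sumOn_diff_tendsto hS (φ * u) v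
  obtain ⟨L₂, h₂⟩ := sumOn_diff_tendsto hS u (φ * v)
  obtain ⟨L₃, h₃⟩ := sumOn_diff_tendsto hS (u * v) φ
  have h₄ : Tendsto (fun m => sumOn S m fun w => diff s φ w * (diff s u w * diff s v w))
      atTop (𝓝 0) := by
    obtain ⟨M, hM0, hM⟩ := diff_uniform φ
    obtain ⟨C, hC⟩ := graphEnergy_bounded u
    obtain ⟨D, hD⟩ := graphEnergy_bounded v
    have hM' : ∀ m, 0 ≤ M m := fun m => (norm_nonneg _).trans (hM m fun _ => 0)
    refine squeeze_zero_norm (a := fun m => M m * (C + D)) (fun m => ?_)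
      (by simpa using hM0.mul_const (C + D))
    have b1 : ‖sumOn S m fun w => diff s φ w * (diff s u w * diff s v w)‖ ≤
        M m * (graphEnergy s m u + graphEnergy s m v) := by
      classical
      unfold graphEnergy
      rw [← edgeSum_add, ← edgeSum_mul]
      refine (norm_sum_le _ _).trans (Finset.sum_le_sum fun w _ => ?_)
      have hw := hM m w
      have : ‖diff s φ (List.ofFn w) * (diff s u (List.ofFn w) * diff s v (List.ofFn w))‖ ≤
          M m * (‖diff s u (List.ofFn w)‖ ^ 2 + ‖diff s v (List.ofFn w)‖ ^ 2) := by
        rw [norm_mul, norm_mul]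
        refine mul_le_mul hw ?_ (by positivity) (hM' m)
        nlinarith [sq_nonneg (‖diff s u (List.ofFn w)‖ - ‖diff s v (List.ofFn w)‖),
          sq_nonneg ‖diff s u (List.ofFn w)‖, sq_nonneg ‖diff s v (List.ofFn w)‖]
      beta_reduce
      split_ifs
      · exact this
      · rw [norm_zero]; exact (norm_nonneg _).trans this
    exact b1.trans (mul_le_mul_of_nonneg_left (add_le_add (hC m) (hD m)) (hM' m))
  refine ⟨_, (((h₁.const_mul (1 / 2)).add (h₂.const_mul (1 / 2))).add
    ((h₃.const_mul (-1 / 2)).add (h₄.const_mul (-1 / 2)))).congr fun m => ?_⟩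
  simp only [← sumOn_mul, ← sumOn_add]
  congr 1; ext w
  simp only [coe_mul, diff, Pi.mul_apply]
  ring

end limits

/-! ### The Hilbert space of 1-forms -/

/-- The elementary form `𝟙_u g ∂f`, given through its values on the edges of all the graphs. -/
def elementary (s : ℝ) (u : Word) (g f : VStar s → ℂ) : Word → ℂ := fun w =>
  if u <+: w then g (left s w) * diff s f w else 0

/-- The linear span of the elementary forms `𝟙_u g ∂f` with `g, f ∈ 𝓕`. -/
def preFormSpan (s : ℝ) : Submodule ℂ (Word → ℂ) :=
  Submodule.span ℂ {ω | ∃ (u : Word) (g f : finiteEnergy s), ω = elementary s u g f}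

lemma elementary_pairing_tendsto {s : ℝ} (u v : Word) (g f k h : finiteEnergy s) :
    ∃ L, Tendsto (fun m => edgeSum m fun w =>
      conj (elementary s u g f w) * elementary s v k h w) atTop (𝓝 L) := by
  have hS : Hereditary {w : Word | u <+: w ∧ v <+: w} := fun w hw j =>
    ⟨hw.1.trans (List.prefix_append _ _), hw.2.trans (List.prefix_append _ _)⟩
  obtain ⟨L, hL⟩ := sumOn_left_tendsto hS (star g * k) (star f) h
  refine ⟨L, hL.congr fun m => ?_⟩
  classical
  unfold sumOn
  refine Finset.sum_congr rfl fun w _ => ?_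
  simp only [elementary, coe_mul, coe_star, diff_star, Pi.mul_apply, Pi.star_apply,
    Set.mem_ofPred_eq]
  by_cases h1 : u <+: List.ofFn w <;> by_cases h2 : v <+: List.ofFn w <;> simp [h1, h2]
  ring

lemma pairing_tendsto {s : ℝ} {ω η : Word → ℂ} (hω : ω ∈ preFormSpan s) (hη : η ∈ preFormSpan s) :
    ∃ L, Tendsto (fun m => edgeSum m fun w => conj (ω w) * η w) atTop (𝓝 L) := by
  have addL (ω ω' η : Word → ℂ) (m : ℕ) : (edgeSum m fun w => conj ((ω + ω') w) * η w) =
      (edgeSum m fun w => conj (ω w) * η w) + edgeSum m fun w => conj (ω' w) * η w := by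
    rw [← edgeSum_add]; congr 1; ext w; simp [add_mul]
  have addR (ω η η' : Word → ℂ) (m : ℕ) : (edgeSum m fun w => conj (ω w) * (η + η') w) =
      (edgeSum m fun w => conj (ω w) * η w) + edgeSum m fun w => conj (ω w) * η' w := by
    rw [← edgeSum_add]; congr 1; ext w; simp [mul_add]
  have smulL (c : ℂ) (ω η : Word → ℂ) (m : ℕ) : (edgeSum m fun w => conj ((c • ω) w) * η w) =
      conj c * edgeSum m fun w => conj (ω w) * η w := by
    rw [← edgeSum_mul]; congr 1; ext w; simp [mul_assoc]
  have smulR (c : ℂ) (ω η : Word → ℂ) (m : ℕ) : (edgeSum m fun w => conj (ω w) * (c • η) w) =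
      c * edgeSum m fun w => conj (ω w) * η w := by
    rw [← edgeSum_mul]; congr 1; ext w; simp; ring
  have main (η : Word → ℂ) (hη : ∀ (u : Word) (g f : finiteEnergy s), ∃ L, Tendsto
      (fun m => edgeSum m fun w => conj (elementary s u g f w) * η w) atTop (𝓝 L)) :
      ∃ L, Tendsto (fun m => edgeSum m fun w => conj (ω w) * η w) atTop (𝓝 L) := by
    unfold preFormSpan at hω
    induction hω using Submodule.span_induction with
    | mem ω h => obtain ⟨u, g, f, rfl⟩ := h; exact hη u g f
    | zero => exact ⟨0, by simp [edgeSum]⟩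
    | add ω ω' _ _ h h' =>
      obtain ⟨L, hL⟩ := h
      obtain ⟨L', hL'⟩ := h'
      exact ⟨L + L', by simpa only [addL] using hL.add hL'⟩
    | smul c ω _ h =>
      obtain ⟨L, hL⟩ := h
      exact ⟨conj c * L, by simpa only [smulL] using hL.const_mul (conj c)⟩
  refine main η fun u g f => ?_
  unfold preFormSpan at hη
  induction hη using Submodule.span_induction with
  | mem η h => obtain ⟨v, k, h, rfl⟩ := h; exact elementary_pairing_tendsto u v g f k h
  | zero => exact ⟨0, by simp [edgeSum]⟩
  | add η η' _ _ h h' =>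
    obtain ⟨L, hL⟩ := h
    obtain ⟨L', hL'⟩ := h'
    exact ⟨L + L', by simpa only [addR] using hL.add hL'⟩
  | smul c η _ h =>
    obtain ⟨L, hL⟩ := h
    exact ⟨c * L, by simpa only [smulR] using hL.const_mul c⟩

/-- The space of finite linear combinations of elementary forms `𝟙_u g ∂f`, before completion. -/
def PreForm (s : ℝ) : Type := ↥(preFormSpan s)

instance (s : ℝ) : AddCommGroup (PreForm s) := inferInstanceAs (AddCommGroup ↥(preFormSpan s))

instance (s : ℝ) : Module ℂ (PreForm s) := inferInstanceAs (Module ℂ ↥(preFormSpan s))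

/-- The value of a form on the edge of the word `w`. -/
def PreForm.val {s : ℝ} : PreForm s →ₗ[ℂ] (Word → ℂ) := (preFormSpan s).subtype

/-- The inner product, `⟪ω, η⟫ = lim_m ∑_{|w|=m} conj (ω w) * η w`, linear in `η`. On elementary
forms `⟪c ∂d, a ∂b⟫ = ∫ a conj c dΓ(b, d)`, where `Γ` is the energy measure. -/
def PreForm.pairing {s : ℝ} (ω η : PreForm s) : ℂ :=
  limUnder atTop fun m => edgeSum m fun w => conj (ω.val w) * η.val w

lemma PreForm.tendsto_pairing {s : ℝ} (ω η : PreForm s) :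
    Tendsto (fun m => edgeSum m fun w => conj (ω.val w) * η.val w) atTop (𝓝 (ω.pairing η)) :=
  tendsto_nhds_limUnder (pairing_tendsto ω.2 η.2)

lemma PreForm.tendsto_pairing_self {s : ℝ} (ω : PreForm s) :
    Tendsto (fun m => edgeSum m fun w => ‖ω.val w‖ ^ 2) atTop (𝓝 (ω.pairing ω).re) := by
  refine ((Complex.continuous_re.tendsto _).comp (ω.tendsto_pairing ω)).congr fun m => ?_
  simp only [Function.comp, edgeSum, Complex.re_sum, Complex.conj_mul']
  norm_cast

instance (s : ℝ) : PreInnerProductSpace.Core ℂ (PreForm s) where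
  inner ω η := ω.pairing η
  conj_inner_symm ω η := by
    refine tendsto_nhds_unique (((Complex.continuous_conj.tendsto _).comp
      (η.tendsto_pairing ω)).congr fun m => ?_) (ω.tendsto_pairing η)
    simp [Function.comp, edgeSum, mul_comm]
  re_inner_nonneg ω :=
    ge_of_tendsto' ω.tendsto_pairing_self fun m => edgeSum_nonneg fun w => by positivity
  add_left ω ω' η := by
    refine tendsto_nhds_unique ((ω + ω').tendsto_pairing η)
      (((ω.tendsto_pairing η).add (ω'.tendsto_pairing η)).congr fun m => ?_)
    rw [← edgeSum_add]; congr 1; ext w; simp [add_mul]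
  smul_left ω η c := by
    refine tendsto_nhds_unique ((c • ω).tendsto_pairing η)
      (((ω.tendsto_pairing η).const_mul (conj c)).congr fun m => ?_)
    rw [← edgeSum_mul]; congr 1; ext w; simp [mul_assoc]

instance (s : ℝ) : SeminormedAddCommGroup (PreForm s) :=
  InnerProductSpace.Core.toSeminormedAddCommGroup (𝕜 := ℂ)

instance (s : ℝ) : InnerProductSpace ℂ (PreForm s) :=
  InnerProductSpace.ofCore inferInstance

/-- The Hilbert space `𝓗` of complex 1-forms. -/
abbrev OneForm (s : ℝ) : Type := UniformSpace.Completion (PreForm s)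

lemma PreForm.tendsto_norm_sq {s : ℝ} (ω : PreForm s) :
    Tendsto (fun m => edgeSum m fun w => ‖ω.val w‖ ^ 2) atTop (𝓝 (‖ω‖ ^ 2)) := by
  have h : ‖ω‖ ^ 2 = (ω.pairing ω).re := norm_sq_eq_re_inner (𝕜 := ℂ) ω
  rw [h]; exact ω.tendsto_pairing_self

/-- A linear operator on the forms which acts on the edges through a bounded multiplier. -/
def multiplier {s : ℝ} (q : Word → ℂ) (hq : ∃ C, ∀ w, ‖q w‖ ≤ C)
    (h : ∀ ω ∈ preFormSpan s, (fun w => q w * ω w) ∈ preFormSpan s) :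
    PreForm s →L[ℂ] PreForm s :=
  LinearMap.mkContinuousOfExistsBound
    { toFun := fun ω => (⟨fun w => q w * ω.val w, h _ ω.2⟩ : ↥(preFormSpan s))
      map_add' := fun ω η => Subtype.ext (funext fun w => mul_add (q w) (ω.val w) (η.val w))
      map_smul' := fun c ω => Subtype.ext (funext fun w => mul_left_comm (q w) c (ω.val w)) } <| by
    obtain ⟨C, hC⟩ := hq
    refine ⟨|C|, fun ω => ?_⟩
    refine le_of_sq_le_sq ?_ (by positivity)
    rw [mul_pow]
    refine le_of_tendsto_of_tendsto' (PreForm.tendsto_norm_sq _)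
      (ω.tendsto_norm_sq.const_mul _) fun m => ?_
    rw [← edgeSum_mul]
    refine edgeSum_mono fun w => ?_
    change ‖q w * ω.val w‖ ^ 2 ≤ _
    rw [norm_mul, mul_pow]
    exact mul_le_mul_of_nonneg_right
      (pow_le_pow_left₀ (norm_nonneg _) ((hC w).trans (le_abs_self C)) 2) (by positivity)

lemma mul_mem_preFormSpan {s : ℝ} (g : finiteEnergy s) (ω : Word → ℂ) (hω : ω ∈ preFormSpan s) :
    (fun w => (g : VStar s → ℂ) (left s w) * ω w) ∈ preFormSpan s := by
  unfold preFormSpan at hω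
  induction hω using Submodule.span_induction with
  | mem ω h =>
    obtain ⟨u, k, f, rfl⟩ := h
    refine Submodule.subset_span ⟨u, g * k, f, ?_⟩
    funext w
    simp only [elementary, coe_mul, Pi.mul_apply]
    split_ifs <;> ring
  | zero =>
    convert (preFormSpan s).zero_mem using 1
    funext w; exact mul_zero _
  | add ω ω' _ _ h h' =>
    convert (preFormSpan s).add_mem h h' using 1
    funext w; exact mul_add _ _ _
  | smul c ω _ h =>
    convert (preFormSpan s).smul_mem c h using 1
    funext w; exact mul_left_comm _ _ _

lemma restrict_mem_preFormSpan {s : ℝ} (v : Word) (ω : Word → ℂ) (hω : ω ∈ preFormSpan s) :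
    (fun w => (if v <+: w then (1 : ℂ) else 0) * ω w) ∈ preFormSpan s := by
  unfold preFormSpan at hω
  induction hω using Submodule.span_induction with
  | mem ω h =>
    obtain ⟨u, g, f, rfl⟩ := h
    by_cases h1 : u <+: v
    · refine Submodule.subset_span ⟨v, g, f, ?_⟩
      funext w
      by_cases h3 : v <+: w
      · simp [elementary, h3, h1.trans h3]
      · simp [elementary, h3]
    · by_cases h2 : v <+: u
      · refine Submodule.subset_span ⟨u, g, f, ?_⟩
        funext w
        by_cases h3 : u <+: w
        · simp [elementary, h3, h2.trans h3]
        · simp [elementary, h3]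
      · convert (preFormSpan s).zero_mem using 1
        funext w
        by_cases h3 : u <+: w <;> by_cases h4 : v <+: w <;> simp [elementary, h3, h4]
        exact ((List.prefix_or_prefix_of_prefix h3 h4).elim h1 h2).elim
  | zero =>
    convert (preFormSpan s).zero_mem using 1
    funext w; exact mul_zero _
  | add ω ω' _ _ h h' =>
    convert (preFormSpan s).add_mem h h' using 1
    funext w; exact mul_add _ _ _
  | smul c ω _ h =>
    convert (preFormSpan s).smul_mem c h using 1
    funext w; exact mul_left_comm _ _ _

/-- Multiplication of 1-forms by `g ∈ 𝓕`; on elementary forms `g (𝟙_u k ∂f) = 𝟙_u (g k) ∂f`. -/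
def mulForm {s : ℝ} (g : finiteEnergy s) : OneForm s →L[ℂ] OneForm s :=
  (multiplier (fun w => (g : VStar s → ℂ) (left s w))
    (by obtain ⟨C, hC⟩ := finiteEnergy_bounded g; exact ⟨C, fun w => hC _⟩)
    (mul_mem_preFormSpan g)).completion

/-- Multiplication of 1-forms by the characteristic function `𝟙_v` of the cell of the word `v`,
that is, restriction to the edges in this cell. -/
def restrictForm {s : ℝ} (v : Word) : OneForm s →L[ℂ] OneForm s :=
  (multiplier (fun w => if v <+: w then (1 : ℂ) else 0)
    ⟨1, fun w => by split_ifs <;> simp⟩ (restrict_mem_preFormSpan v)).completion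

/-- The form `∂f` before completion. -/
def preD {s : ℝ} : finiteEnergy s →ₗ[ℂ] PreForm s where
  toFun f := (⟨diff s f, Submodule.subset_span ⟨[], 1, f, by ext w; simp [elementary]⟩⟩ :
    ↥(preFormSpan s))
  map_add' f g := Subtype.ext (funext fun w => diff_add _ _ w)
  map_smul' c f := Subtype.ext (funext fun w => diff_smul c _ w)

/-- The derivation `∂ : 𝓕 → 𝓗`. -/
def derivation {s : ℝ} : finiteEnergy s →ₗ[ℂ] OneForm s :=
  (UniformSpace.Completion.toComplL (𝕜 := ℂ) (E := PreForm s)).toLinearMap ∘ₗ preD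

lemma norm_derivation_sq {s : ℝ} (f : finiteEnergy s) : ‖derivation f‖ ^ 2 = energy s f := by
  have h : ‖derivation f‖ = ‖preD f‖ := UniformSpace.Completion.norm_coe _
  rw [h]
  exact tendsto_nhds_unique (PreForm.tendsto_norm_sq _) (tendsto_nhds_limUnder f.2.2)

/-- The real-valued 1-forms: the closure in `𝓗` of the forms with real values on all edges. -/
def IsRealForm {s : ℝ} (a : OneForm s) : Prop :=
  a ∈ closure ((fun ω : PreForm s => (ω : OneForm s)) '' {ω | ∀ w, (ω.val w).im = 0})

/-- The magnetic form `E^a(f) = ‖(∂ + i a) f‖²`. -/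
def magneticEnergy {s : ℝ} (a : OneForm s) (f : finiteEnergy s) : ℝ :=
  ‖derivation f + Complex.I • mulForm f a‖ ^ 2

/-! ### The forms that are exact at scale `m` -/

/-- The space `𝓗_m` spanned by the `𝟙_w ∂A` with `|w| = m` and `A` harmonic at scale `m`. -/
def scaleForms (s : ℝ) (m : ℕ) : Submodule ℂ (OneForm s) :=
  Submodule.span ℂ {η | ∃ (w : Word) (A : finiteEnergy s), w.length = m ∧
    IsHarmonicAtScale s m A ∧ η = restrictForm w (derivation A)}

section scale

variable {s : ℝ}

lemma edgeSum_eq_zero {m : ℕ} {φ : Word → ℝ} (h0 : ∀ w, 0 ≤ φ w) (h : edgeSum m φ = 0) (w : Word)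
    (hw : w.length = m) : φ w = 0 := by
  subst hw
  unfold edgeSum at h
  rw [Finset.sum_eq_zero_iff_of_nonneg fun _ _ => h0 _] at h
  have := h w.get (Finset.mem_univ _)
  rwa [List.ofFn_get] at this

lemma isHarmonicAtScale_iff {n : ℕ} {f : finiteEnergy s} : IsHarmonicAtScale s n f ↔
    ∀ w : Word, n ≤ w.length → diff s f (w ++ [0]) - diff s f (w ++ [1]) = 0 ∧
      diff s f (w ++ [2]) - diff s f (w ++ [3]) = 0 := by
  have step (m : ℕ) : graphEnergy s (m + 1) f = graphEnergy s m f + edgeSum m fun w =>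
      (‖diff s f (w ++ [0]) - diff s f (w ++ [1])‖ ^ 2 +
        ‖diff s f (w ++ [2]) - diff s f (w ++ [3])‖ ^ 2) / 2 := by
    unfold graphEnergy
    rw [edgeSum_succ, ← edgeSum_add]
    congr 1; ext w; exact sum_children _ w
  constructor
  · intro h w hw
    have h1 := step w.length
    rw [h _ (hw.trans (Nat.le_succ _)), h _ hw, left_eq_add] at h1
    have h2 := edgeSum_eq_zero (fun w => by positivity) h1 w rfl
    have p1 := sq_nonneg ‖diff s f (w ++ [0]) - diff s f (w ++ [1])‖
    have p2 := sq_nonneg ‖diff s f (w ++ [2]) - diff s f (w ++ [3])‖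
    constructor
    · rw [← norm_eq_zero, ← sq_eq_zero_iff]; linarith
    · rw [← norm_eq_zero, ← sq_eq_zero_iff]; linarith
  · intro h m hm
    induction m, hm using Nat.le_induction with
    | base => rfl
    | succ m hm ih =>
      rw [step, ih, add_eq_left]
      refine Finset.sum_eq_zero fun w _ => ?_
      obtain ⟨h1, h2⟩ := h (List.ofFn w) (by simpa using hm)
      simp [h1, h2]

lemma IsHarmonicAtScale.zero (n : ℕ) : IsHarmonicAtScale s n 0 :=
  isHarmonicAtScale_iff.2 fun w _ => by simp [diff]

lemma IsHarmonicAtScale.add {n : ℕ} {f g : finiteEnergy s} (hf : IsHarmonicAtScale s n f)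
    (hg : IsHarmonicAtScale s n g) : IsHarmonicAtScale s n (f + g) :=
  isHarmonicAtScale_iff.2 fun w hw => by
    obtain ⟨h1, h2⟩ := isHarmonicAtScale_iff.1 hf w hw
    obtain ⟨h3, h4⟩ := isHarmonicAtScale_iff.1 hg w hw
    simp only [coe_add, diff_add]
    exact ⟨by linear_combination h1 + h3, by linear_combination h2 + h4⟩

lemma IsHarmonicAtScale.smul {n : ℕ} {f : finiteEnergy s} (c : ℂ)
    (hf : IsHarmonicAtScale s n f) : IsHarmonicAtScale s n (c • f) :=
  isHarmonicAtScale_iff.2 fun w hw => by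
    obtain ⟨h1, h2⟩ := isHarmonicAtScale_iff.1 hf w hw
    simp only [coe_smul, diff_smul]
    exact ⟨by linear_combination c * h1, by linear_combination c * h2⟩

lemma IsHarmonicAtScale.diff_append {n : ℕ} {f : finiteEnergy s} (hf : IsHarmonicAtScale s n f)
    {w : Word} (hw : n ≤ w.length) (t : Word) :
    diff s f (w ++ t) = (1 / 2) ^ t.length * diff s f w := by
  induction t using List.reverseRecOn with
  | nil => simp
  | append_singleton t j ih =>
    obtain ⟨h1, h2⟩ := isHarmonicAtScale_iff.1 hf (w ++ t) (by simp; omega)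
    obtain ⟨h3, h4⟩ := diff_children (s := s) f (w ++ t)
    have key : diff s f (w ++ t ++ [j]) = 1 / 2 * diff s f (w ++ t) := by
      fin_cases j
      · change diff s f (w ++ t ++ [0]) = _
        linear_combination (h1 + h3) / 2
      · change diff s f (w ++ t ++ [1]) = _
        linear_combination (h3 - h1) / 2
      · change diff s f (w ++ t ++ [2]) = _
        linear_combination (h2 + h4) / 2
      · change diff s f (w ++ t ++ [3]) = _
        linear_combination (h4 - h2) / 2
    rw [← List.append_assoc, key, ih, List.length_append, List.length_singleton, pow_succ]
    ring

/-- On a cell of scale `n`, a form that is exact at scale `n` is determined by its value on the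
edge of the cell. -/
lemma restrictForm_derivation_eq {n : ℕ} {f g : finiteEnergy s} (hf : IsHarmonicAtScale s n f)
    (hg : IsHarmonicAtScale s n g) {w : Word} (hw : w.length = n) (c : ℂ)
    (h : diff s f w = c * diff s g w) :
    restrictForm w (derivation f) = c • restrictForm w (derivation g) := by
  rw [← map_smul, ← map_smul]
  change (multiplier _ _ _).completion ((preD f : PreForm s) : OneForm s) =
    (multiplier _ _ _).completion ((preD (c • g) : PreForm s) : OneForm s)
  rw [ContinuousLinearMap.completion_apply_coe, ContinuousLinearMap.completion_apply_coe]
  congr 1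
  refine Subtype.ext (funext fun v => ?_)
  change (if w <+: v then (1 : ℂ) else 0) * diff s f v =
    (if w <+: v then (1 : ℂ) else 0) * diff s (c • g : finiteEnergy s) v
  split_ifs with hv
  · obtain ⟨t, rfl⟩ := hv
    rw [coe_smul, diff_smul, hf.diff_append hw.ge, hg.diff_append hw.ge, h]
    ring
  · simp

instance (m : ℕ) : FiniteDimensional ℂ (scaleForms s m) := by
  have hex (w : Fin m → Fin 4) : ∃ B : finiteEnergy s, ∀ A : finiteEnergy s,
      IsHarmonicAtScale s m A → ∃ c : ℂ, restrictForm (List.ofFn w) (derivation A) =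
        c • restrictForm (List.ofFn w) (derivation B) := by
    by_cases h : ∃ B : finiteEnergy s, IsHarmonicAtScale s m B ∧ diff s B (List.ofFn w) ≠ 0
    · obtain ⟨B, hB, hB0⟩ := h
      exact ⟨B, fun A hA => ⟨diff s A (List.ofFn w) / diff s B (List.ofFn w),
        restrictForm_derivation_eq hA hB (by simp) _ (by field_simp)⟩⟩
    · push Not at h
      exact ⟨0, fun A hA => ⟨0, restrictForm_derivation_eq hA (.zero m) (by simp) 0
        (by simp [h A hA])⟩⟩
  choose B hB using hex
  have hle : scaleForms s m ≤ Submodule.span ℂ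
      (Set.range fun w : Fin m → Fin 4 => restrictForm (List.ofFn w) (derivation (B w))) := by
    refine Submodule.span_le.2 ?_
    rintro _ ⟨w, A, rfl, hA, rfl⟩
    obtain ⟨c, hc⟩ := hB w.get A hA
    rw [List.ofFn_get] at hc
    rw [hc]
    refine Submodule.smul_mem _ _ (Submodule.subset_span ⟨w.get, ?_⟩)
    simp only [List.ofFn_get]
  have := FiniteDimensional.span_of_finite ℂ (Set.finite_range
    fun w : Fin m → Fin 4 => restrictForm (List.ofFn w) (derivation (B w)))
  exact Submodule.finiteDimensional_of_le hle

/-- Every `η ∈ 𝓗_m` is of the form `∑_{|w|=m} 𝟙_w ∂A_w` with all `A_w` harmonic at scale `m`. -/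
lemma exists_potentials {m : ℕ} {η : OneForm s} (hη : η ∈ scaleForms s m) :
    ∃ A : Word → finiteEnergy s, (∀ w, IsHarmonicAtScale s m (A w)) ∧
      η = edgeSum m fun w => restrictForm w (derivation (A w)) := by
  classical
  unfold scaleForms at hη
  induction hη using Submodule.span_induction with
  | mem η h =>
    obtain ⟨w, A, rfl, hA, rfl⟩ := h
    refine ⟨fun v => if v = w then A else 0, fun v => ?_, ?_⟩
    · beta_reduce
      split_ifs
      exacts [hA, .zero _]
    · unfold edgeSum
      rw [Finset.sum_eq_single w.get]
      · simp [List.ofFn_get]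
      · intro v _ hv
        have : List.ofFn v ≠ w := fun h => hv (by
          apply List.ofFn_injective
          rw [h, List.ofFn_get])
        simp [this]
      · simp
  | zero => exact ⟨0, fun _ => .zero m, by simp [edgeSum]⟩
  | add η η' _ _ h h' =>
    obtain ⟨A, hA, rfl⟩ := h
    obtain ⟨B, hB, rfl⟩ := h'
    exact ⟨A + B, fun w => (hA w).add (hB w), by simp [← edgeSum_add]⟩
  | smul c η _ h =>
    obtain ⟨A, hA, rfl⟩ := h
    exact ⟨c • A, fun w => (hA w).smul c, by simp [edgeSum, Finset.smul_sum]⟩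

end scale

/-- The orthogonal projection `Tr_m : 𝓗 → 𝓗_m`. -/
def trace {s : ℝ} (m : ℕ) (a : OneForm s) : scaleForms s m :=
  (scaleForms s m).orthogonalProjectionOnto a

/-- Functions `A_w`, harmonic at scale `m`, with `η = ∑_{|w|=m} 𝟙_w ∂A_w`; on the cell of `w`
the function `A_w` is unique up to a constant. -/
def potential {s : ℝ} {m : ℕ} (η : scaleForms s m) (w : Word) : finiteEnergy s :=
  (exists_potentials η.2).choose w

/-- The value `η(e_{xy}) = A_w(y) - A_w(x)` of `η ∈ 𝓗_m` on the edge of the word `w`, `|w| = m`,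
directed from `x = F_w(-1,0)` to `y = F_w(1,0)`; on the reversed edge it is the opposite. -/
def edgeValue {s : ℝ} {m : ℕ} (η : scaleForms s m) (w : Word) : ℂ :=
  diff s (potential η w) w

/-- The graph magnetic form `E_n^η(f) = (1/2) ∑_{x ∈ V_n} ∑_{y ∼_n x} |f x - f y e^{i η(e_{xy})}|²`
of `η ∈ 𝓗_n`: a sum over the directed edges, that is, over the words of length `n` with the
two directions of the edge of each word. -/
def graphMagneticEnergy {s : ℝ} (n : ℕ) (η : scaleForms s n) (f : VStar s → ℂ) : ℝ :=
  1 / 2 * edgeSum n fun w =>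
    ‖f (left s w) - f (right s w) * Complex.exp (Complex.I * edgeValue η w)‖ ^ 2 +
      ‖f (right s w) - f (left s w) * Complex.exp (Complex.I * -edgeValue η w)‖ ^ 2

end DiamondFractal

end

noncomputable section

namespace DiamondFractal

/-! ### Sums over the edges and their truncated words -/

-- At scale `n` everything is compared in the `ℓ²` norm `edgeNorm n` over the edges. As the edge
-- values `α` of `a_n` are real, the two directions of an edge contribute equally, so the graph
-- magnetic energy is the squared norm of `∂f + f(x)(1 - e^{-iα})`, with `x` the left end point and
-- `∂f` the increment of `f` (`graphMagneticEnergy_eq`). Replacing `1 - e^{-iα}` by `iα` costs at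
-- most `C · sup|α| · ‖a‖` (`tendsto_edgeNorm_exp_sub`), and it remains to see that the norm of `∂f
-- + i f α` tends to that of `∂f + i f a` (`tendsto_edgeNorm_magnetic`).
--
-- The first coordinate is harmonic at every scale and has a nonzero increment on every edge, so its
-- restrictions to the cells generate `𝓗_n`. Hence `stepForm s n` identifies `ℓ²` of the scale `n`
-- edges isometrically with `𝓗_n`, with inverse `edgeValue` (`eq_stepForm`, `norm_stepForm`), and
-- projecting to `𝓗_n` becomes a contraction of edge values.
--
-- The crux is density: a preform `ω` is the limit of the step forms that have its own values on the
-- scale `n` edges (`tendsto_norm_sub_stepForm`). For `𝟙_u g ∂f` the error is the energy of `f`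
-- missed at scale `n`, plus the oscillation of `g` inside the cells. The latter is bounded only in
-- an averaged `ℓ²` sense, but it is multiplied by the increments of `f`, which tend to zero
-- uniformly.
--
-- Density has two consequences. The values of `a_n` are `ℓ²`-close to those of a preform `ω` near
-- `a`, for which the limit of edge norms is the definition of the norm in `𝓗`. They also tend to
-- zero uniformly, because the values of a fixed step form halve at each scale.

lemma exists_ofFn_eq {n : ℕ} {w : Word} (h : w.length = n) :
    ∃ v : Fin n → Fin 4, List.ofFn v = w := by
  subst h; exact ⟨w.get, List.ofFn_get w⟩

lemma edgeSum_congr {M : Type*} [AddCommMonoid M] {m : ℕ} {φ ψ : Word → M}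
    (h : ∀ w : Word, w.length = m → φ w = ψ w) : edgeSum m φ = edgeSum m ψ :=
  Finset.sum_congr rfl fun _ _ => h _ (by simp)

lemma edgeSum_le_edgeSum {m : ℕ} {φ ψ : Word → ℝ}
    (h : ∀ w : Word, w.length = m → φ w ≤ ψ w) : edgeSum m φ ≤ edgeSum m ψ :=
  Finset.sum_le_sum fun _ _ => h _ (by simp)

lemma le_edgeSum {m : ℕ} {φ : Word → ℝ} (h : ∀ w, 0 ≤ φ w) {w : Word} (hw : w.length = m) :
    φ w ≤ edgeSum m φ := by
  obtain ⟨v, rfl⟩ := exists_ofFn_eq hw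
  exact Finset.single_le_sum (f := fun v : Fin m → Fin 4 => φ (List.ofFn v))
    (fun _ _ => h _) (Finset.mem_univ v)

lemma edgeSum_single {M : Type*} [AddCommMonoid M] {m : ℕ} {φ : Word → M} {w : Word}
    (hw : w.length = m) (h : ∀ v : Word, v.length = m → v ≠ w → φ v = 0) :
    edgeSum m φ = φ w := by
  obtain ⟨v, rfl⟩ := exists_ofFn_eq hw
  exact Finset.sum_eq_single v (fun u _ hu => h _ (by simp) fun e => hu (List.ofFn_injective e))
    (by simp)

lemma edgeSum_take {R : Type*} [CommSemiring R] {n m : ℕ} (h : n ≤ m) (φ : Word → R) :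
    edgeSum m (fun w => φ (w.take n)) = 4 ^ (m - n) * edgeSum n φ := by
  induction m, h using Nat.le_induction with
  | base => simpa using edgeSum_congr fun w hw => by rw [← hw, List.take_length]
  | succ m hm ih =>
    rw [edgeSum_succ, Nat.succ_sub hm, pow_succ', mul_assoc, ← ih, ← edgeSum_mul]
    refine edgeSum_congr fun w hw => ?_
    simp [List.take_append_of_le_length (hm.trans hw.ge)]

/-- The increments along the four children of an edge add up to twice its own increment, once for
each half of the diamond. Each refinement therefore contributes a factor 2. -/
lemma edgeSum_take_mul_diff {s : ℝ} {n m : ℕ} (h : n ≤ m) (ψ : Word → ℂ) (f : VStar s → ℂ) :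
    edgeSum m (fun w => ψ (w.take n) * diff s f w) =
      2 ^ (m - n) * edgeSum n fun w => ψ w * diff s f w := by
  induction m, h using Nat.le_induction with
  | base => simpa using edgeSum_congr fun w hw => by rw [← hw, List.take_length]
  | succ m hm ih =>
    rw [edgeSum_succ, Nat.succ_sub hm, pow_succ', mul_assoc, ← ih, ← edgeSum_mul]
    refine edgeSum_congr fun w hw => ?_
    obtain ⟨h1, h2⟩ := diff_children f w
    simp only [List.take_append_of_le_length (hm.trans hw.ge), Fin.sum_univ_four]
    linear_combination ψ (w.take n) * (h1 + h2)

/-! ### The `ℓ²` norm of the values on the edges of one scale -/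

/-- The `ℓ²` norm of the restriction of `φ` to the words of length `m`. -/
def edgeNorm (m : ℕ) (φ : Word → ℂ) : ℝ :=
  ‖(WithLp.toLp 2 fun w : Fin m → Fin 4 => φ (List.ofFn w) : EuclideanSpace ℂ (Fin m → Fin 4))‖

lemma edgeNorm_nonneg (m : ℕ) (φ : Word → ℂ) : 0 ≤ edgeNorm m φ := norm_nonneg _

lemma edgeNorm_sq (m : ℕ) (φ : Word → ℂ) : edgeNorm m φ ^ 2 = edgeSum m fun w => ‖φ w‖ ^ 2 := by
  rw [edgeNorm, EuclideanSpace.norm_sq_eq]; rfl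

lemma edgeNorm_add_le (m : ℕ) (φ ψ : Word → ℂ) :
    edgeNorm m (fun w => φ w + ψ w) ≤ edgeNorm m φ + edgeNorm m ψ :=
  norm_add_le (WithLp.toLp 2 fun w : Fin m → Fin 4 => φ (List.ofFn w) :
    EuclideanSpace ℂ (Fin m → Fin 4)) (WithLp.toLp 2 fun w : Fin m → Fin 4 => ψ (List.ofFn w))

lemma edgeNorm_mono {m : ℕ} {φ ψ : Word → ℂ} {C : ℝ} (hC : 0 ≤ C)
    (h : ∀ w : Word, w.length = m → ‖φ w‖ ≤ C * ‖ψ w‖) : edgeNorm m φ ≤ C * edgeNorm m ψ := by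
  refine le_of_sq_le_sq ?_ (mul_nonneg hC (edgeNorm_nonneg _ _))
  rw [mul_pow, edgeNorm_sq, edgeNorm_sq, ← edgeSum_mul]
  refine edgeSum_le_edgeSum fun w hw => ?_
  rw [← mul_pow]
  exact pow_le_pow_left₀ (norm_nonneg _) (h w hw) 2

lemma edgeNorm_congr {m : ℕ} {φ ψ : Word → ℂ} (h : ∀ w : Word, w.length = m → ‖φ w‖ = ‖ψ w‖) :
    edgeNorm m φ = edgeNorm m ψ :=
  le_antisymm (by simpa using edgeNorm_mono zero_le_one fun w hw => by simp [h w hw])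
    (by simpa using edgeNorm_mono zero_le_one fun w hw => by simp [h w hw])

lemma norm_le_edgeNorm {m : ℕ} (φ : Word → ℂ) {w : Word} (hw : w.length = m) :
    ‖φ w‖ ≤ edgeNorm m φ := by
  refine le_of_sq_le_sq ?_ (edgeNorm_nonneg _ _)
  rw [edgeNorm_sq]
  exact le_edgeSum (φ := fun w => ‖φ w‖ ^ 2) (fun _ => by positivity) hw

lemma edgeNorm_sub_le (m : ℕ) (φ ψ : Word → ℂ) :
    |edgeNorm m φ - edgeNorm m ψ| ≤ edgeNorm m fun w => φ w - ψ w :=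
  abs_norm_sub_norm_le (WithLp.toLp 2 fun w : Fin m → Fin 4 => φ (List.ofFn w) :
    EuclideanSpace ℂ (Fin m → Fin 4)) (WithLp.toLp 2 fun w : Fin m → Fin 4 => ψ (List.ofFn w))

/-- A word of length `n` has `4 ^ (m - n)` extensions of length `m`; the factor is the square root
of this number. -/
lemma edgeNorm_take {n m : ℕ} (h : n ≤ m) (φ : Word → ℂ) :
    edgeNorm m (fun w => φ (w.take n)) = 2 ^ (m - n) * edgeNorm n φ := by
  refine (sq_eq_sq₀ (edgeNorm_nonneg _ _)
    (mul_nonneg (by positivity) (edgeNorm_nonneg _ _))).1 ?_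
  rw [mul_pow, edgeNorm_sq, edgeNorm_sq, edgeSum_take h fun w => ‖φ w‖ ^ 2, ← pow_mul, mul_comm _ 2,
    pow_mul]
  norm_num

lemma PreForm.tendsto_edgeNorm {s : ℝ} (ω : PreForm s) :
    Tendsto (fun m => edgeNorm m ω.val) atTop (𝓝 ‖ω‖) := by
  have h := (Real.continuous_sqrt.tendsto _).comp ω.tendsto_norm_sq
  rw [Real.sqrt_sq (norm_nonneg _)] at h
  refine h.congr fun m => ?_
  rw [Function.comp, ← edgeNorm_sq, Real.sqrt_sq (edgeNorm_nonneg _ _)]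

/-! ### The first coordinate and the forms that are constant on cells -/

lemma cellMap_fst_sub (s : ℝ) (w : Word) (p q : ℝ × ℝ) :
    (cellMap s w q).1 - (cellMap s w p).1 = (1 / 2) ^ w.length * (q.1 - p.1) := by
  induction w with
  | nil => simp [cellMap]
  | cons j w ih =>
    have e (r : ℝ × ℝ) : cellMap s (j :: w) r = ifsMap s j (cellMap s w r) := rfl
    rw [e, e, List.length_cons, pow_succ]
    simp only [ifsMap]
    linear_combination ih / 2

lemma abs_fst_le {s : ℝ} {m : ℕ} {p : ℝ × ℝ} (hp : p ∈ vertices s m) : |p.1| ≤ 1 := by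
  induction m generalizing p with
  | zero => rcases hp with rfl | rfl <;> simp
  | succ m ih =>
    obtain ⟨j, q, hq, rfl⟩ := Set.mem_iUnion.1 hp
    have := abs_le.1 (ih hq)
    rw [abs_le]
    fin_cases j <;> simp [ifsMap] <;> constructor <;> linarith

/-- The first coordinate as a function on `V_*`. -/
def coordFun (s : ℝ) (p : VStar s) : ℂ := ((p : ℝ × ℝ).1 : ℂ)

lemma diff_coordFun (s : ℝ) (w : Word) : diff s (coordFun s) w = 2 * (1 / 2) ^ w.length := by
  have h := cellMap_fst_sub s w (-1, 0) (1, 0)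
  have : diff s (coordFun s) w =
      (((cellMap s w (1, 0)).1 - (cellMap s w (-1, 0)).1 : ℝ) : ℂ) := by
    simp [diff, coordFun, left, right]
  rw [this, h]; push_cast; ring

/-- There are `4 ^ m` edges, and each carries the squared increment `4 * (1 / 4) ^ m`. The
independence of `m` is what makes the first coordinate harmonic at every scale. -/
lemma graphEnergy_coordFun (s : ℝ) (m : ℕ) : graphEnergy s m (coordFun s) = 4 := by
  have h : graphEnergy s m (coordFun s) = edgeSum m fun _ => 4 * (1 / 4) ^ m := by
    refine edgeSum_congr fun w hw => ?_
    rw [diff_coordFun, hw, norm_mul, norm_pow, mul_pow, ← pow_mul, mul_comm m 2, pow_mul]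
    norm_num
  rw [h]
  simp only [edgeSum, Finset.sum_const, Finset.card_univ, Fintype.card_fun, Fintype.card_fin,
    nsmul_eq_mul]
  push_cast
  rw [mul_left_comm, ← mul_pow]
  norm_num

/-- The first coordinate as an element of `𝓕`. -/
def coord (s : ℝ) : finiteEnergy s :=
  ⟨coordFun s, isFiniteEnergy_iff.2 ⟨⟨1, fun p => by
    obtain ⟨m, hm⟩ := Set.mem_iUnion.1 p.2
    simpa [coordFun] using abs_fst_le hm⟩, 4, fun m => (graphEnergy_coordFun s m).le⟩⟩

lemma diff_coord (s : ℝ) (w : Word) : diff s (coord s) w = 2 * (1 / 2) ^ w.length :=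
  diff_coordFun s w

lemma isHarmonicAtScale_coord (s : ℝ) (n : ℕ) : IsHarmonicAtScale s n (coord s) := fun m _ =>
  (graphEnergy_coordFun s m).trans (graphEnergy_coordFun s n).symm

/-- The form `𝟙_v ∂x₁` before completion. -/
def cellForm (s : ℝ) (v : Word) : PreForm s :=
  multiplier (fun w => if v <+: w then (1 : ℂ) else 0)
    ⟨1, fun w => by split_ifs <;> simp⟩ (restrict_mem_preFormSpan v) (preD (coord s))

lemma val_cellForm (s : ℝ) (v w : Word) :
    (cellForm s v).val w = if v <+: w then 2 * (1 / 2) ^ w.length else 0 := by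
  change (if v <+: w then (1 : ℂ) else 0) * diff s (coord s) w = _
  rw [diff_coord]; split_ifs <;> simp

lemma coe_cellForm (s : ℝ) (v : Word) :
    (cellForm s v : OneForm s) = restrictForm v (derivation (coord s)) :=
  (ContinuousLinearMap.completion_apply_coe _ _).symm

/-- The form with the value `c v` on the edge of each word `v` of length `n`, which is divided
equally along the two halves of each cell of a smaller scale. -/
def stepForm (s : ℝ) (n : ℕ) : (Word → ℂ) →ₗ[ℂ] PreForm s :=
  -- The factor `2 ^ n / 2` is the inverse of the increment of the first coordinate across a cell of
  -- scale `n`. Linearity in `c` is used for differences and for span induction.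
  edgeSum n fun v => (LinearMap.proj v).smulRight ((2 ^ n / 2 : ℂ) • cellForm s v)

lemma stepForm_apply (s : ℝ) (n : ℕ) (c : Word → ℂ) :
    stepForm s n c = edgeSum n fun v => c v • (2 ^ n / 2 : ℂ) • cellForm s v := by
  simp [stepForm, edgeSum, LinearMap.sum_apply]

lemma val_stepForm (s : ℝ) {n : ℕ} (c : Word → ℂ) {w : Word} (hw : n ≤ w.length) :
    (stepForm s n c).val w = (1 / 2) ^ (w.length - n) * c (w.take n) := by
  have h : (stepForm s n c).val w =
      edgeSum n fun v => c v * (2 ^ n / 2 * (cellForm s v).val w) := by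
    rw [stepForm_apply]
    simp [edgeSum, map_sum]
  rw [h, edgeSum_single (w := w.take n) (by simpa using hw)]
  · obtain ⟨k, hk⟩ := Nat.exists_eq_add_of_le hw
    rw [val_cellForm, if_pos (List.take_prefix _ _), hk, Nat.add_sub_cancel_left, pow_add]
    field_simp
    rw [mul_assoc, ← mul_pow]; norm_num
  · intro v hv hne
    rw [val_cellForm, if_neg]
    · simp
    · intro hp
      exact hne (by rw [List.prefix_iff_eq_take.1 hp, hv])

lemma coe_stepForm_mem (s : ℝ) (n : ℕ) (c : Word → ℂ) :
    (stepForm s n c : OneForm s) ∈ scaleForms s n := by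
  have h : (stepForm s n c : OneForm s) =
      ∑ v : Fin n → Fin 4, (c (List.ofFn v) * (2 ^ n / 2)) •
        restrictForm (List.ofFn v) (derivation (coord s)) := by
    rw [stepForm_apply, edgeSum]
    change UniformSpace.Completion.toComplL (𝕜 := ℂ) (E := PreForm s) _ = _
    rw [map_sum]
    refine Finset.sum_congr rfl fun v _ => ?_
    rw [← coe_cellForm, smul_smul, map_smul]
    rfl
  rw [h]
  exact Submodule.sum_mem _ fun v _ => Submodule.smul_mem _ _ (Submodule.subset_span
    ⟨_, coord s, by simp, isHarmonicAtScale_coord s n, rfl⟩)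

/-- On each cell the chosen potential and the first coordinate are both harmonic at scale `n`, so
their derivations there are proportional, with the ratio of increments as factor. Every element of
`𝓗_n` is thus the step form of its edge values. -/
lemma eq_stepForm {s : ℝ} {n : ℕ} (η : scaleForms s n) :
    (η : OneForm s) = (stepForm s n (edgeValue η) : OneForm s) := by
  obtain ⟨hA, hη⟩ := (exists_potentials η.2).choose_spec
  refine hη.trans ?_
  rw [stepForm_apply, edgeSum, edgeSum]
  change _ = UniformSpace.Completion.toComplL (𝕜 := ℂ) (E := PreForm s) _
  rw [map_sum]
  refine Finset.sum_congr rfl fun v _ => ?_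
  rw [smul_smul, map_smul]
  change _ = _ • (cellForm s (List.ofFn v) : OneForm s)
  rw [coe_cellForm]
  refine restrictForm_derivation_eq (hA _) (isHarmonicAtScale_coord s n) (by simp) _ ?_
  rw [diff_coord, List.length_ofFn]
  change edgeValue η (List.ofFn v) = _
  field_simp
  rw [mul_assoc, ← mul_pow]; norm_num

/-- From scale `n` on, the edge norm is constant: each refinement multiplies the number of edges by
4 and halves the values. -/
lemma norm_stepForm (s : ℝ) (n : ℕ) (c : Word → ℂ) : ‖stepForm s n c‖ = edgeNorm n c := by
  refine tendsto_nhds_unique (stepForm s n c).tendsto_edgeNorm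
    (tendsto_const_nhds.congr' ?_)
  filter_upwards [eventually_ge_atTop n] with m hm
  have h : edgeNorm m (stepForm s n c).val =
      edgeNorm m fun w => (fun v => (1 / 2) ^ (m - n) * c v) (w.take n) :=
    edgeNorm_congr fun w hw => by rw [val_stepForm s c (hm.trans hw.ge), hw]
  rw [h, edgeNorm_take hm fun v => (1 / 2) ^ (m - n) * c v]
  refine (sq_eq_sq₀ (edgeNorm_nonneg _ _)
    (mul_nonneg (by positivity) (edgeNorm_nonneg _ _))).1 ?_
  rw [mul_pow, edgeNorm_sq, edgeNorm_sq, ← edgeSum_mul]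
  refine edgeSum_congr fun w _ => ?_
  rw [norm_mul, norm_pow, ← mul_pow, ← mul_assoc, norm_div, ← mul_pow]
  norm_num

lemma inner_stepForm (s : ℝ) (n : ℕ) (c d : Word → ℂ) :
    inner ℂ (stepForm s n c) (stepForm s n d) = edgeSum n fun w => conj (c w) * d w := by
  refine tendsto_nhds_unique ((stepForm s n c).tendsto_pairing (stepForm s n d))
    (tendsto_const_nhds.congr' ?_)
  filter_upwards [eventually_ge_atTop n] with m hm
  have h : (edgeSum m fun w => conj ((stepForm s n c).val w) * (stepForm s n d).val w) =
      edgeSum m fun w => (fun v => (1 / 4) ^ (m - n) * (conj (c v) * d v)) (w.take n) := by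
    refine edgeSum_congr fun w hw => ?_
    rw [val_stepForm s c (hm.trans hw.ge), val_stepForm s d (hm.trans hw.ge), hw]
    have : (1 / 4 : ℂ) = 1 / 2 * (1 / 2) := by norm_num
    rw [this, mul_pow, map_mul, map_pow, map_div₀, map_one, map_ofNat]
    ring
  rw [h, edgeSum_take hm fun v => (1 / 4) ^ (m - n) * (conj (c v) * d v), edgeSum_mul,
    ← mul_assoc, ← mul_pow]
  norm_num

/-! ### Density of the forms that are constant on cells -/

/-- Children 1 and 2 start at the left end point of the parent. Children 0 and 3 start at the two
middle vertices, which are the right end points of 1 and 2. -/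
lemma sub_left_child {s : ℝ} (f : VStar s → ℂ) (w : Word) :
    f (left s (w ++ [0])) - f (left s w) = diff s f (w ++ [1]) ∧
      f (left s (w ++ [1])) - f (left s w) = 0 ∧ f (left s (w ++ [2])) - f (left s w) = 0 ∧
        f (left s (w ++ [3])) - f (left s w) = diff s f (w ++ [2]) := by
  have e (p q : ℝ × ℝ) (i j : Fin 4) (h : ifsMap s i p = ifsMap s j q) :
      cellMap s (w ++ [i]) p = cellMap s (w ++ [j]) q := by simp [cellMap, h]
  have e' (p q : ℝ × ℝ) (i : Fin 4) (h : ifsMap s i p = q) :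
      cellMap s (w ++ [i]) p = cellMap s w q := by simp [cellMap, h]
  have h2 : left s (w ++ [0]) = right s (w ++ [1]) :=
    Subtype.ext (e _ _ 0 1 (by simp [ifsMap]; norm_num))
  have h3 : left s (w ++ [1]) = left s w :=
    Subtype.ext (e' _ _ 1 (by simp [ifsMap]; norm_num))
  have h4 : left s (w ++ [2]) = left s w :=
    Subtype.ext (e' _ _ 2 (by simp [ifsMap]; norm_num))
  have h5 : right s (w ++ [2]) = left s (w ++ [3]) :=
    Subtype.ext (e _ _ 2 3 (by simp [ifsMap]; norm_num))
  simp [diff, h2, h3, h4, h5]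

/-- The oscillation of `g` at the left end points between two successive scales is controlled by
the energy. -/
lemma edgeNorm_sub_left_take_succ {s : ℝ} (g : VStar s → ℂ) (m : ℕ) :
    edgeNorm (m + 1) (fun w => g (left s w) - g (left s (w.take m))) ≤
      √(graphEnergy s (m + 1) g) := by
  refine Real.le_sqrt_of_sq_le ?_
  rw [edgeNorm_sq, graphEnergy, edgeSum_succ, edgeSum_succ]
  refine edgeSum_le_edgeSum fun w hw => ?_
  have ht (j : Fin 4) : (w ++ [j]).take m = w := by
    rw [List.take_append_of_le_length hw.ge, ← hw, List.take_length]
  obtain ⟨h0, h1, h2, h3⟩ := sub_left_child g w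
  simp only [ht, Fin.sum_univ_four, h0, h1, h2, h3, norm_zero]
  -- The oscillation only involves children 1 and 2; the other two terms of the energy are
  -- discarded.
  nlinarith [sq_nonneg ‖diff s g (w ++ [0])‖, sq_nonneg ‖diff s g (w ++ [3])‖]

/-- Up to normalization this is the mean square oscillation of `g` inside the cells of scale `n`. It
serves in place of a modulus of continuity for `g`. -/
lemma edgeNorm_sub_left_take {s : ℝ} {g : VStar s → ℂ} {E : ℝ} (hE : ∀ m, graphEnergy s m g ≤ E)
    {n m : ℕ} (h : n ≤ m) :
    (1 / 2) ^ (m - n) * edgeNorm m (fun w => g (left s w) - g (left s (w.take n))) ≤ √E := by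
  -- The stronger bound makes the induction close. The norms obey `N (m + 1) ≤ √E + 2 * N m`, where
  -- the 2 comes from the four children of each word, so the weighted norms are bounded by a partial
  -- geometric sum.
  suffices (1 / 2) ^ (m - n) * edgeNorm m (fun w => g (left s w) - g (left s (w.take n))) ≤
      (1 - (1 / 2) ^ (m - n)) * √E by
    refine this.trans (mul_le_of_le_one_left (Real.sqrt_nonneg _) ?_)
    have : (0 : ℝ) ≤ (1 / 2) ^ (m - n) := by positivity
    linarith
  induction m, h using Nat.le_induction with
  | base =>
    have h0 : edgeNorm n (fun w => g (left s w) - g (left s (w.take n))) ≤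
        0 * edgeNorm n fun _ => 0 :=
      edgeNorm_mono le_rfl fun w hw => by simp [← hw]
    simpa using h0
  | succ m hm ih =>
    have h1 : edgeNorm (m + 1) (fun w => g (left s w) - g (left s (w.take n))) ≤
        √E + 2 * edgeNorm m (fun w => g (left s w) - g (left s (w.take n))) := by
      have h2 := edgeNorm_take (Nat.le_succ m) fun w => g (left s w) - g (left s (w.take n))
      simp only [Nat.succ_eq_add_one, Nat.add_sub_cancel_left, pow_one] at h2
      rw [← h2]
      refine le_trans (le_of_eq (edgeNorm_congr fun w _ => ?_)) ((edgeNorm_add_le _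
        (fun w => g (left s w) - g (left s (w.take m))) _).trans (add_le_add_left
          ((edgeNorm_sub_left_take_succ g m).trans (Real.sqrt_le_sqrt (hE _))) _))
      simp [List.take_take, hm]
    rw [Nat.succ_sub hm, pow_succ]
    have h3 : (0 : ℝ) ≤ (1 / 2) ^ (m - n) := by positivity
    nlinarith [mul_le_mul_of_nonneg_left h1 h3]

/-- Pythagoras: the subtracted term spreads the increments of scale `n` harmonically, and
`edgeSum_take_mul_diff` makes each cross term equal to the energy at scale `n`. The total is `E_m -
2 E_n + E_n`. -/
lemma edgeNorm_diff_sub_take {s : ℝ} (f : VStar s → ℂ) {n m : ℕ} (h : n ≤ m) :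
    edgeNorm m (fun w => diff s f w - (1 / 2) ^ (m - n) * diff s f (w.take n)) =
      √(graphEnergy s m f - graphEnergy s n f) := by
  rw [← Real.sqrt_sq (edgeNorm_nonneg m _), edgeNorm_sq]
  congr 1
  have hn (k : ℕ) : (graphEnergy s k f : ℂ) =
      edgeSum k fun w => diff s f w * diff s (star f) w := by
    simp [graphEnergy, edgeSum, diff_star, Complex.mul_conj']
  have key : ((edgeSum m fun w =>
      ‖diff s f w - (1 / 2) ^ (m - n) * diff s f (w.take n)‖ ^ 2 : ℝ) : ℂ) =
      edgeSum m (fun w => diff s f w * diff s (star f) w) +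
        ((-(1 / 2) ^ (m - n)) * edgeSum m (fun w => diff s f (w.take n) * diff s (star f) w) +
          ((-(1 / 2) ^ (m - n)) * edgeSum m (fun w => diff s (star f) (w.take n) * diff s f w) +
            (1 / 4) ^ (m - n) * edgeSum m (fun w => (fun v => diff s f v * diff s (star f) v)
              (w.take n)))) := by
    rw [← edgeSum_mul, ← edgeSum_mul, ← edgeSum_mul, ← edgeSum_add, ← edgeSum_add, ← edgeSum_add]
    simp only [edgeSum, Complex.ofReal_sum]
    refine Finset.sum_congr rfl fun w _ => ?_
    have : (1 / 4 : ℂ) = 1 / 2 * (1 / 2) := by norm_num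
    rw [this, mul_pow, Complex.ofReal_pow, ← Complex.mul_conj', map_sub, map_mul, map_pow,
      map_div₀, map_one, map_ofNat, diff_star, diff_star]
    ring
  have hp : (1 / 2 : ℂ) ^ (m - n) * 2 ^ (m - n) = 1 := by rw [← mul_pow]; norm_num
  have hq : (1 / 4 : ℂ) ^ (m - n) * 4 ^ (m - n) = 1 := by rw [← mul_pow]; norm_num
  rw [edgeSum_take_mul_diff h, edgeSum_take_mul_diff h,
    edgeSum_take h fun v => diff s f v * diff s (star f) v] at key
  simp only [mul_comm (diff s (star f) _)] at key
  rw [← hn, ← hn] at key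
  apply Complex.ofReal_injective
  rw [key]
  push_cast
  linear_combination (-2 * (graphEnergy s n f : ℂ)) * hp + (graphEnergy s n f : ℂ) * hq

lemma val_sub_stepForm {s : ℝ} (ω : PreForm s) {n : ℕ} (c : Word → ℂ) {w : Word}
    (hw : n ≤ w.length) :
    (ω - stepForm s n c).val w = ω.val w - (1 / 2) ^ (w.length - n) * c (w.take n) := by
  rw [map_sub, Pi.sub_apply, val_stepForm s c hw]

/-- With `v` the truncation of `w` to length `n`, the error on `w` splits as `g(x_w)` times the
deviation of the increment of `f` from its harmonic part, plus `g(x_w) - g(x_v)` times that harmonic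
part. The first piece is paid for by `sup |g|` and the missing energy of `f`, the second by `sup
|diff f|` at scale `n` and the energy of `g`. -/
lemma norm_sub_stepForm_elementary_le {s : ℝ} {u : Word} {g f : VStar s → ℂ} {C M E L : ℝ} {n : ℕ}
    (hn : u.length ≤ n) (hC : ∀ x, ‖g x‖ ≤ C) (hM : ∀ w : Word, w.length = n → ‖diff s f w‖ ≤ M)
    (hE : ∀ m, graphEnergy s m g ≤ E) (hL : ∀ m, graphEnergy s m f ≤ L)
    (ω : PreForm s) (hω : ω.val = elementary s u g f) :
    ‖ω - stepForm s n ω.val‖ ≤ C * √(L - graphEnergy s n f) + M * √E := by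
  have hC0 : 0 ≤ C := (norm_nonneg _).trans (hC (left s []))
  have hM0 : 0 ≤ M := (norm_nonneg _).trans (hM (List.replicate n 0) (by simp))
  refine le_of_tendsto (PreForm.tendsto_edgeNorm _) ?_
  filter_upwards [eventually_ge_atTop n] with m hm
  have h1 := edgeNorm_mono (m := m) hC0 (φ := fun w => if u <+: w then
    g (left s w) * (diff s f w - (1 / 2) ^ (m - n) * diff s f (w.take n)) else 0)
    (ψ := fun w => diff s f w - (1 / 2) ^ (m - n) * diff s f (w.take n)) (fun w _ => by
      split_ifs
      · rw [norm_mul]; exact mul_le_mul_of_nonneg_right (hC _) (norm_nonneg _)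
      · rw [norm_zero]; positivity)
  have h2 := edgeNorm_mono (m := m) (C := M * (1 / 2) ^ (m - n)) (by positivity)
    (φ := fun w => if u <+: w then
      (g (left s w) - g (left s (w.take n))) * ((1 / 2) ^ (m - n) * diff s f (w.take n)) else 0)
    (ψ := fun w => g (left s w) - g (left s (w.take n))) (fun w hw => by
      split_ifs
      · have := hM (w.take n) (by simp [hw, hm])
        rw [norm_mul, norm_mul, norm_pow, mul_comm]
        refine mul_le_mul_of_nonneg_right ?_ (norm_nonneg _)
        rw [mul_comm]
        refine mul_le_mul this (by norm_num) (by positivity) hM0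
      · rw [norm_zero]; positivity)
  rw [edgeNorm_diff_sub_take f hm] at h1
  have h3 := mul_le_mul_of_nonneg_left (edgeNorm_sub_left_take hE hm) hM0
  have h4 := mul_le_mul_of_nonneg_left
    (Real.sqrt_le_sqrt (sub_le_sub_right (hL m) (graphEnergy s n f))) hC0
  refine le_trans (le_of_eq (edgeNorm_congr fun w hw => ?_))
    ((edgeNorm_add_le _ _ _).trans (add_le_add (h1.trans h4) ((h2.trans_eq (mul_assoc _ _ _)).trans
      h3)))
  rw [val_sub_stepForm _ _ (hm.trans hw.ge), hω, hw]
  -- Since `u` is no longer than `n`, truncation to length `n` does not affect the factor `𝟙_u`.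
  have hiff : u <+: w.take n ↔ u <+: w := by
    rw [List.prefix_take_iff]; exact and_iff_left hn
  simp only [elementary, hiff]
  split_ifs
  · congr 1; ring
  · simp

lemma tendsto_norm_sub_stepForm {s : ℝ} (ω : PreForm s) :
    Tendsto (fun n => ‖ω - stepForm s n ω.val‖) atTop (𝓝 0) := by
  suffices ∀ φ ∈ preFormSpan s, ∃ ω : PreForm s, ω.val = φ ∧
      Tendsto (fun n => ‖ω - stepForm s n ω.val‖) atTop (𝓝 0) by
    obtain ⟨η, hη, h⟩ := this ω.val ω.2
    rwa [show η = ω from Subtype.ext hη] at h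
  intro φ hφ
  unfold preFormSpan at hφ
  induction hφ using Submodule.span_induction with
  | mem φ h =>
    obtain ⟨u, g, f, rfl⟩ := h
    obtain ⟨C, hC⟩ := finiteEnergy_bounded g
    obtain ⟨E, hE⟩ := graphEnergy_bounded g
    obtain ⟨M, hM0, hM⟩ := diff_uniform f
    obtain ⟨L, hL⟩ := f.2.2
    have hlim : Tendsto (fun n => C * √(L - graphEnergy s n f) + M n * √E) atTop (𝓝 0) := by
      have h1 := (Real.continuous_sqrt.tendsto _).comp (hL.const_sub L)
      simpa using (h1.const_mul C).add (hM0.mul_const √E)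
    refine ⟨(⟨_, Submodule.subset_span ⟨u, g, f, rfl⟩⟩ : ↥(preFormSpan s)), rfl,
      squeeze_zero' (.of_forall fun n => norm_nonneg _) ?_ hlim⟩
    filter_upwards [eventually_ge_atTop u.length] with n hn
    exact norm_sub_stepForm_elementary_le hn hC (fun w hw => by
      obtain ⟨v, rfl⟩ := exists_ofFn_eq hw
      exact hM n v) hE (fun m => (graphEnergy_mono (f : VStar s → ℂ)).ge_of_tendsto hL m) _ rfl
  | zero => exact ⟨0, map_zero _, by simp⟩
  | add φ ψ _ _ h h' =>
    obtain ⟨ω, rfl, h⟩ := h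
    obtain ⟨η, rfl, h'⟩ := h'
    refine ⟨ω + η, map_add _ _ _,
      squeeze_zero (fun n => norm_nonneg _) (fun n => ?_) (by simpa using h.add h')⟩
    rw [map_add, map_add, add_sub_add_comm]
    exact norm_add_le _ _
  | smul c φ _ h =>
    obtain ⟨ω, rfl, h⟩ := h
    refine ⟨c • ω, map_smul _ _ _,
      squeeze_zero (fun n => norm_nonneg _) (fun n => ?_) (by simpa using h.const_mul ‖c‖)⟩
    rw [map_smul, map_smul, ← norm_smul, smul_sub]

lemma exists_stepForm_near {s : ℝ} (a : OneForm s) {ε : ℝ} (hε : 0 < ε) :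
    ∃ (n : ℕ) (c : Word → ℂ), ‖a - (stepForm s n c : OneForm s)‖ < ε := by
  obtain ⟨ω, hω⟩ := (Metric.denseRange_iff.1 (UniformSpace.Completion.denseRange_coe
    (α := PreForm s))) a (ε / 2) (half_pos hε)
  obtain ⟨n, hn⟩ := ((tendsto_norm_sub_stepForm ω).eventually_lt_const (half_pos hε)).exists
  refine ⟨n, ω.val, ?_⟩
  rw [dist_eq_norm] at hω
  have h : ‖(ω : OneForm s) - (stepForm s n ω.val : OneForm s)‖ = ‖ω - stepForm s n ω.val‖ := by
    rw [← UniformSpace.Completion.coe_sub, UniformSpace.Completion.norm_coe]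
  calc _ ≤ ‖a - (ω : OneForm s)‖ + ‖(ω : OneForm s) - (stepForm s n ω.val : OneForm s)‖ :=
        norm_sub_le_norm_sub_add_norm_sub _ _ _
    _ < ε := by rw [h]; linarith

/-! ### The edge values of the projections -/

/-- The projection fixes the step form, so the left side is the norm of the projection of the
difference, and a projection is a contraction. -/
lemma edgeNorm_edgeValue_trace_sub_le {s : ℝ} (n : ℕ) (a : OneForm s) (c : Word → ℂ) :
    edgeNorm n (fun w => edgeValue (trace n a) w - c w) ≤
      ‖a - (stepForm s n c : OneForm s)‖ := by
  have h1 : edgeNorm n (fun w => edgeValue (trace n a) w - c w) =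
      ‖(trace n a : OneForm s) - (stepForm s n c : OneForm s)‖ := by
    rw [eq_stepForm (trace n a), ← UniformSpace.Completion.coe_sub, ← map_sub,
      UniformSpace.Completion.norm_coe, norm_stepForm]
    rfl
  have h2 : (trace n a : OneForm s) - (stepForm s n c : OneForm s) =
      ((scaleForms s n).orthogonalProjectionOnto (a - (stepForm s n c : OneForm s)) :
        OneForm s) := by
    rw [map_sub, Submodule.coe_sub]
    congr 1
    exact ((scaleForms s n).orthogonalProjectionOnto_mem_subspace_eq_self
      ⟨_, coe_stepForm_mem s n c⟩).symm ▸ rfl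
  rw [h1, h2]
  exact (scaleForms s n).norm_orthogonalProjectionOnto_apply_le _

lemma edgeNorm_edgeValue_trace_le {s : ℝ} (n : ℕ) (a : OneForm s) :
    edgeNorm n (edgeValue (trace n a)) ≤ ‖a‖ := by
  have h := edgeNorm_edgeValue_trace_sub_le n a 0
  simp only [map_zero, UniformSpace.Completion.coe_zero, sub_zero, Pi.zero_apply] at h
  exact h

lemma edgeNorm_edgeValue_trace_sub_val_le {s : ℝ} (n : ℕ) (a : OneForm s) (ω : PreForm s) :
    edgeNorm n (fun w => edgeValue (trace n a) w - ω.val w) ≤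
      ‖a - (ω : OneForm s)‖ + ‖ω - stepForm s n ω.val‖ := by
  refine (edgeNorm_edgeValue_trace_sub_le n a ω.val).trans ?_
  rw [← UniformSpace.Completion.norm_coe (ω - stepForm s n ω.val), UniformSpace.Completion.coe_sub]
  exact norm_sub_le_norm_sub_add_norm_sub _ _ _

/-- Approximate `a` by a step form of a fixed scale `k`: its values at scale `n` carry a factor `(1
/ 2) ^ (n - k)`, and the remaining error is small in `ℓ²`, hence on every single edge. -/
lemma eventually_edgeValue_trace_le {s : ℝ} (a : OneForm s) {δ : ℝ} (hδ : 0 < δ) :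
    ∀ᶠ n in atTop, ∀ w : Word, w.length = n → ‖edgeValue (trace n a) w‖ ≤ δ := by
  obtain ⟨k, c, hc⟩ := exists_stepForm_near a (show 0 < δ / 3 by positivity)
  have ht : Tendsto (fun n : ℕ => (1 / 2 : ℝ) ^ (n - k) * edgeNorm k c) atTop (𝓝 0) := by
    simpa using ((tendsto_pow_atTop_nhds_zero_of_lt_one (r := (1 / 2 : ℝ)) (by norm_num)
      (by norm_num)).comp (tendsto_sub_atTop_nat k)).mul_const (edgeNorm k c)
  filter_upwards [eventually_ge_atTop k, ht.eventually_lt_const (show 0 < δ / 3 by positivity),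
    (tendsto_norm_sub_stepForm (stepForm s k c)).eventually_lt_const
      (show 0 < δ / 3 by positivity)] with n hn h1 h2 w hw
  have h3 := (norm_le_edgeNorm (fun w => edgeValue (trace n a) w - (stepForm s k c).val w)
    hw).trans (edgeNorm_edgeValue_trace_sub_val_le n a (stepForm s k c))
  have h4 : ‖(stepForm s k c).val w‖ ≤ (1 / 2) ^ (n - k) * edgeNorm k c := by
    rw [val_stepForm s c (hn.trans hw.ge), norm_mul, norm_pow, hw]
    refine mul_le_mul (by norm_num) (norm_le_edgeNorm c (by simp [hw, hn])) (norm_nonneg _)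
      (by positivity)
  have h5 := norm_le_norm_sub_add (edgeValue (trace n a) w) ((stepForm s k c).val w)
  linarith

/-- Edge values are coordinates in the orthonormal basis of the step forms of single edges. This
makes them continuous in `a`, so that realness passes to the limit. -/
lemma inner_stepForm_eq_edgeValue_trace {s : ℝ} {n : ℕ} (a : OneForm s) {w : Word}
    (hw : w.length = n) :
    inner ℂ (stepForm s n (Pi.single w 1) : OneForm s) a = edgeValue (trace n a) w := by
  have h1 : inner ℂ (stepForm s n (Pi.single w 1) : OneForm s) a =
      inner ℂ (stepForm s n (Pi.single w 1) : OneForm s) (trace n a : OneForm s) :=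
    ((scaleForms s n).inner_orthogonalProjectionOnto_eq_of_mem_left
      ⟨_, coe_stepForm_mem s n (Pi.single w 1)⟩ a).symm
  rw [h1, eq_stepForm (trace n a), UniformSpace.Completion.inner_coe, inner_stepForm,
    edgeSum_single hw]
  · simp
  · intro v _ hv; simp [hv]

lemma edgeValue_trace_im {s : ℝ} {a : OneForm s} (ha : IsRealForm a) {n : ℕ} {w : Word}
    (hw : w.length = n) : (edgeValue (trace n a) w).im = 0 := by
  rw [← inner_stepForm_eq_edgeValue_trace a hw]
  have hcl : IsClosed {b : OneForm s |
      (inner ℂ (stepForm s n (Pi.single w 1) : OneForm s) b).im = 0} :=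
    isClosed_eq (by fun_prop) continuous_const
  refine closure_minimal ?_ hcl ha
  rintro _ ⟨ω, hω, rfl⟩
  rw [Set.mem_ofPred_eq, UniformSpace.Completion.inner_coe]
  refine tendsto_nhds_unique ((Complex.continuous_im.tendsto _).comp
    ((stepForm s n (Pi.single w 1)).tendsto_pairing ω)) (tendsto_const_nhds.congr' ?_)
  filter_upwards [eventually_ge_atTop n] with m hm
  rw [Function.comp, edgeSum, Complex.im_sum, Finset.sum_eq_zero]
  intro v _
  rw [val_stepForm s _ (by simpa using hm), Complex.mul_im, hω, mul_zero, zero_add]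
  -- The values of the basis form are real, so its pairing with a real preform is real at each scale
  -- from `n` on.
  have : conj ((1 / 2 : ℂ) ^ ((List.ofFn v).length - n) *
      Pi.single (M := fun _ => ℂ) w 1 ((List.ofFn v).take n)) =
      (((1 / 2 : ℝ) ^ ((List.ofFn v).length - n) *
        Pi.single (M := fun _ => ℝ) w 1 ((List.ofFn v).take n) : ℝ) : ℂ) := by
    simp only [Pi.single_apply]
    rw [map_mul, map_pow, map_div₀, map_one, map_ofNat]
    split_ifs <;> simp
  rw [this, Complex.ofReal_im, zero_mul]

/-! ### Convergence of the magnetic energies -/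

lemma tendsto_edgeNorm_magnetic_preForm {s : ℝ} (f : finiteEnergy s) (ω : PreForm s) :
    Tendsto (fun n => edgeNorm n fun w =>
        diff s f w + Complex.I * ((f : VStar s → ℂ) (left s w) * ω.val w)) atTop
      (𝓝 ‖derivation f + Complex.I • mulForm f (ω : OneForm s)‖) := by
  set η : PreForm s := preD f + Complex.I •
    multiplier (fun w => (f : VStar s → ℂ) (left s w))
      (by obtain ⟨C, hC⟩ := finiteEnergy_bounded f; exact ⟨C, fun w => hC _⟩)
      (mul_mem_preFormSpan f) ω with hη
  have h : derivation f + Complex.I • mulForm f (ω : OneForm s) = (η : OneForm s) := by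
    rw [hη, mulForm, ContinuousLinearMap.completion_apply_coe, UniformSpace.Completion.coe_add,
      UniformSpace.Completion.coe_smul]
    rfl
  rw [h, UniformSpace.Completion.norm_coe]
  exact η.tendsto_edgeNorm

lemma tendsto_edgeNorm_magnetic {s : ℝ} (f : finiteEnergy s) (a : OneForm s) :
    Tendsto (fun n => edgeNorm n fun w => diff s f w +
        Complex.I * ((f : VStar s → ℂ) (left s w) * edgeValue (trace n a) w)) atTop
      (𝓝 ‖derivation f + Complex.I • mulForm f a‖) := by
  obtain ⟨C, hC⟩ := finiteEnergy_bounded f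
  have hC0 : 0 ≤ C := (norm_nonneg _).trans (hC (left s []))
  rw [Metric.tendsto_atTop']
  intro ε hε
  set K := ‖mulForm f‖
  have hK : 0 ≤ K := norm_nonneg _
  -- Three errors are added: `2 * C * δ` for the edge values, `K * δ` for the limit form, and `ε /
  -- 4` for the preform. Their sum is at most `3 * ε / 4`; the summand 1 keeps the denominator
  -- positive.
  set δ := ε / (4 * (C + K + 1)) with hδ
  have hδ0 : 0 < δ := by positivity
  have hδε : δ * (C + K + 1) = ε / 4 := by rw [hδ]; field_simp
  obtain ⟨k, c, hc⟩ := exists_stepForm_near a hδ0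
  set ω := stepForm s k c
  have e1 := (tendsto_norm_sub_stepForm ω).eventually_lt_const hδ0
  have e2 := (tendsto_edgeNorm_magnetic_preForm f ω).eventually
    (Metric.ball_mem_nhds _ (show 0 < ε / 4 by positivity))
  obtain ⟨N, hN⟩ := eventually_atTop.1 (e1.and e2)
  refine ⟨N, fun n hn => ?_⟩
  obtain ⟨h1, h2⟩ := hN n hn.le
  rw [Real.dist_eq] at h2
  rw [Real.dist_eq]
  have h3 := edgeNorm_sub_le n (fun w => diff s f w +
      Complex.I * ((f : VStar s → ℂ) (left s w) * edgeValue (trace n a) w))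
    (fun w => diff s f w + Complex.I * ((f : VStar s → ℂ) (left s w) * ω.val w))
  have h4 : (edgeNorm n fun w => (diff s f w +
      Complex.I * ((f : VStar s → ℂ) (left s w) * edgeValue (trace n a) w)) -
      (diff s f w + Complex.I * ((f : VStar s → ℂ) (left s w) * ω.val w))) ≤
      C * edgeNorm n fun w => edgeValue (trace n a) w - ω.val w := by
    refine edgeNorm_mono hC0 fun w _ => ?_
    rw [add_sub_add_left_eq_sub, ← mul_sub, ← mul_sub, norm_mul, norm_mul, Complex.norm_I, one_mul]
    exact mul_le_mul_of_nonneg_right (hC _) (norm_nonneg _)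
  have h5 := mul_le_mul_of_nonneg_left (edgeNorm_edgeValue_trace_sub_val_le n a ω) hC0
  have h6 : |‖derivation f + Complex.I • mulForm f (ω : OneForm s)‖ -
      ‖derivation f + Complex.I • mulForm f a‖| ≤ K * δ := by
    refine (abs_norm_sub_norm_le _ _).trans ?_
    rw [add_sub_add_left_eq_sub, ← smul_sub, ← map_sub, norm_smul, Complex.norm_I, one_mul]
    refine ((mulForm f).le_opNorm _).trans (mul_le_mul_of_nonneg_left ?_ hK)
    rw [norm_sub_rev]; exact hc.le
  have h7 : C * (‖a - (ω : OneForm s)‖ + ‖ω - stepForm s n ω.val‖) ≤ C * (2 * δ) :=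
    mul_le_mul_of_nonneg_left (by linarith) hC0
  have h8 := h3.trans (h4.trans (h5.trans h7))
  rw [abs_le] at h8 h6
  rw [abs_lt] at h2 ⊢
  constructor <;> nlinarith

/-- A real edge value gives a phase of modulus one, and multiplication by this phase exchanges the
terms of the two directions up to sign. Their equality absorbs the factor `1 / 2`. -/
lemma graphMagneticEnergy_eq {s : ℝ} {n : ℕ} {η : scaleForms s n}
    (hη : ∀ w : Word, w.length = n → (edgeValue η w).im = 0) (f : VStar s → ℂ) :
    graphMagneticEnergy n η f = edgeNorm n (fun w => diff s f w +
      f (left s w) * (1 - Complex.exp (-(Complex.I * edgeValue η w)))) ^ 2 := by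
  rw [edgeNorm_sq, graphMagneticEnergy, ← edgeSum_mul]
  refine edgeSum_congr fun w hw => ?_
  have hre : edgeValue η w = ((edgeValue η w).re : ℂ) := Complex.ext rfl (by simp [hη w hw])
  have h1 : ‖Complex.exp (Complex.I * edgeValue η w)‖ = 1 := by
    rw [hre, mul_comm, Complex.norm_exp_ofReal_mul_I]
  have h2 : f (left s w) - f (right s w) * Complex.exp (Complex.I * edgeValue η w) =
      -(Complex.exp (Complex.I * edgeValue η w) *
        (f (right s w) - f (left s w) * Complex.exp (Complex.I * -edgeValue η w))) := by
    have : Complex.exp (Complex.I * edgeValue η w) * Complex.exp (Complex.I * -edgeValue η w) =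
        1 := by rw [← Complex.exp_add]; simp
    linear_combination (-f (left s w)) * this
  rw [h2, norm_neg, norm_mul, h1, one_mul, mul_neg]
  have h3 : diff s f w + f (left s w) * (1 - Complex.exp (-(Complex.I * edgeValue η w))) =
      f (right s w) - f (left s w) * Complex.exp (-(Complex.I * edgeValue η w)) := by
    simp only [diff]; ring
  rw [h3]; ring

lemma tendsto_edgeNorm_exp_sub {s : ℝ} (f : finiteEnergy s) (a : OneForm s) :
    Tendsto (fun n => edgeNorm n fun w => (diff s f w + (f : VStar s → ℂ) (left s w) *
        (1 - Complex.exp (-(Complex.I * edgeValue (trace n a) w)))) - (diff s f w +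
        Complex.I * ((f : VStar s → ℂ) (left s w) * edgeValue (trace n a) w))) atTop (𝓝 0) := by
  obtain ⟨C, hC⟩ := finiteEnergy_bounded f
  have hC0 : 0 ≤ C := (norm_nonneg _).trans (hC (left s []))
  rw [Metric.tendsto_atTop']
  intro ε hε
  -- The bound 1 allows `|e^z - 1 - z| ≤ |z|²`, of which one factor is at most `δ` and the other is
  -- summed in `ℓ²` to at most `‖a‖`.
  set δ := min 1 (ε / (2 * (C * ‖a‖ + 1))) with hδ
  have hδ0 : 0 < δ := by positivity
  have hδε : δ * (C * ‖a‖ + 1) ≤ ε / 2 := by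
    refine (mul_le_mul_of_nonneg_right (min_le_right _ _) (by positivity)).trans (le_of_eq ?_)
    field_simp
  obtain ⟨N, hN⟩ := eventually_atTop.1 (eventually_edgeValue_trace_le a hδ0)
  refine ⟨N, fun n hn => ?_⟩
  rw [Real.dist_eq, sub_zero, abs_of_nonneg (edgeNorm_nonneg _ _)]
  refine (edgeNorm_mono (C := C * δ) (by positivity) (ψ := edgeValue (trace n a))
    fun w hw => ?_).trans_lt ?_
  · set z := -(Complex.I * edgeValue (trace n a) w) with hz
    have hzn : ‖z‖ = ‖edgeValue (trace n a) w‖ := by rw [hz, norm_neg, norm_mul]; simp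
    have h1 := hN n hn.le w hw
    rw [← hzn] at h1 ⊢
    have h2 := Complex.norm_exp_sub_one_sub_id_le (h1.trans (min_le_left _ _))
    have h3 : (diff s f w + (f : VStar s → ℂ) (left s w) * (1 - Complex.exp z)) - (diff s f w +
        Complex.I * ((f : VStar s → ℂ) (left s w) * edgeValue (trace n a) w)) =
        -((f : VStar s → ℂ) (left s w) * (Complex.exp z - 1 - z)) := by
      rw [hz]; ring
    rw [h3, norm_neg, norm_mul, mul_assoc]
    refine mul_le_mul (hC _) (h2.trans ?_) (norm_nonneg _) hC0
    rw [sq]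
    exact mul_le_mul_of_nonneg_right h1 (norm_nonneg _)
  · have := mul_le_mul_of_nonneg_left (edgeNorm_edgeValue_trace_le n a)
      (show 0 ≤ C * δ by positivity)
    nlinarith

end DiamondFractal

end

theorem mainTheorem4 (s : ℝ) (hs₀ : 0 < s) (hs₁ : s ≤ 1 / 8)
    (a : DiamondFractal.OneForm s) (ha : DiamondFractal.IsRealForm a)
    (f : DiamondFractal.finiteEnergy s) :
    Tendsto (fun n => DiamondFractal.graphMagneticEnergy n (DiamondFractal.trace n a) f) atTop
      (𝓝 (DiamondFractal.magneticEnergy a f)) := by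
  -- The edge norms of the exponential and the linearized expressions differ by a null sequence, so
  -- they share their limit, which is then squared.
  have h := (tendsto_zero_iff_abs_tendsto_zero _).2 (squeeze_zero (fun n => abs_nonneg _)
    (fun n => DiamondFractal.edgeNorm_sub_le n _ _) (DiamondFractal.tendsto_edgeNorm_exp_sub f a))
  have h2 := (h.add (DiamondFractal.tendsto_edgeNorm_magnetic f a)).pow 2
  simp only [sub_add_cancel, zero_add] at h2
  refine h2.congr fun n => ?_
  exact (DiamondFractal.graphMagneticEnergy_eq
    (fun w hw => DiamondFractal.edgeValue_trace_im ha hw) _).symm
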